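/- **Setting.** Let $\mathcal H$ be a real Hilbert space and let $N$ agents sit on the vertices of a connected undirected graph. Let $W$ be a nonnegative, symmetric, doubly stochastic $N\times N$ matrix with $W_{ii}>0$, $W_{ij}>0$ on edges and $W_{ij}=0$ for distinct non-adjacent $i,j$. Put $\|Z\|_2=(\sum_n\|Z_n\|^2)^{1/2}$ for $Z\in\mathcal H^N$ and $(WZ)_n=\sum_jW_{nj}Z_j$. A number $\rho\in[0,1)$ is called a contraction factor of $W$ if $\|WZ\|_2\le\rho\|Z\|_2$ whenever $\sum_nZ_n=0$. Let $\mathcal C:\Omega\times\mathcal H\to\mathcal H$ be a (measurable) randomized compressor over a probability space $(\Omega,\nu)$ with parameter $0\le\alpha<1$: $\mathbb E_{\omega\sim\nu}\|\mathcal C(\omega,v)-v\|^2\le\alpha\|v\|^2$ for every $v\in\mathcal H$. Let $\varepsilon>0$, and let $F_t$ be one of the potentials $$F_t^{\mathrm{KT}}(x)=\varepsilon\,\frac{2^t\,\Gamma\big(\frac{t+1}{2}+\frac x2\big)\Gamma\big(\frac{t+1}{2}-\frac x2\big)}{\pi\,t!},\qquad F_t^{\mathrm{SE}}(x)=\frac{\varepsilon}{\sqrt{t+1}}\exp\Big(\frac{x^2}{2(t+1)}\Big).$$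 Put $h_t(x)=\frac{F_t(x+1)-F_t(x-1)}{F_t(x+1)+F_t(x-1)}F_{t-1}(x)$, $\operatorname{Bet}_t(G)=\frac{h_t(\|G\|)}{\|G\|}G$ for $G\ne0$, $\operatorname{Bet}_t(0)=0$, and let $\operatorname{clip}_t$ be the norm projection onto the closed ball of radius $t$ in $\mathcal H$. **Algorithm (DECO-EF)** with step size $\gamma$ and schedule $q:\mathbb N\to\mathbb N$. Start from $G_{n,0}=\widehat G_{n,0}=0$. In round $t=0,1,\dots$, Agent $n$ predicts $x_{n,t}=\operatorname{Bet}_{t+1}(\operatorname{clip}_t(G_{n,t}))$, observes a subgradient $g_{n,t}\in\partial\ell_{n,t}(x_{n,t})$, and sets $Z^0_n=G_{n,t}-g_{n,t}$, $\widehat Z^0_n=\widehat G_{n,t}$. For $k=0,\dots,q(t)-1$ all agents set $$\widehat Z_n^{k+1}=\widehat Z_n^k+\mathcal C(\omega_{n,t}^k,Z_n^k-\widehat Z_n^k),\qquad Z_n^{k+1}=Z_n^k+\gamma\sum_jW_{nj}\big(\widehat Z_j^{k+1}-\widehat Z_n^{k+1}\big).$$ Finally $G_{n,t+1}=Z_n^{q(t)}$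 and $\widehat G_{n,t+1}=\widehat Z_n^{q(t)}$. Each $\omega_{n,t}^k$ has law $\nu$, and the vectors $(\omega_{n,t}^k)_{n}$ are independent over the pairs $(t,k)$. The losses $\ell_{n,t}:\mathcal H\to\mathbb R$ are convex and $1$-Lipschitz; they and the subgradients $g_{n,t}$ may depend (measurably) on the compressor randomness of rounds before $t$. With $\bar\ell_t=\frac1N\sum_n\ell_{n,t}$, the network regret is $$R_T^{\mathrm{net}}(u)=\sum_{t=0}^{T-1}\frac1N\sum_{n=1}^N\bar\ell_t(x_{n,t})-\sum_{t=0}^{T-1}\bar\ell_t(u).$$ **Statement.** $W$ has a contraction factor. Let $\rho$ be any contraction factor of $W$, put $\mu=1-\rho$, and set $$C_{\mathrm{sched}}^{\mathrm{KT}}=48\Big((\varepsilon+1)\big(1+\tfrac{2}{\log 2}\big)+1\Big),\quad C_{\mathrm{sched}}^{\mathrm{SE}}=4e^{3/2}(2\varepsilon+1),\quad C_{\mathrm{reg}}^{P}=3\Big(2+\frac\mu4\Big)\frac{C_{\mathrm{sched}}^{P}}2\sqrt N,$$ $$B^{\mathrm{KT}}(T,r)=r\sqrt{2(T+1)}\sqrt{\log\Big(1+\frac{2e^2\pi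 T(T+1)r^2}{\varepsilon^2}\Big)}+\varepsilon\Big(1-\frac1{e\sqrt{\pi T}}\Big)+C_{\mathrm{reg}}^{\mathrm{KT}}\sqrt T,$$ $$B^{\mathrm{SE}}(T,r)=r\sqrt{(T+1)\log\Big(1+\frac{(T+1)^2r^2}{\varepsilon^2}\Big)}+\varepsilon\Big(1-\frac1{\sqrt{T+1}}\Big)+C_{\mathrm{reg}}^{\mathrm{SE}}\sqrt T.$$ Then for each $P\in\{\mathrm{KT},\mathrm{SE}\}$: 1. $B^P(T,r)=\widetilde O(\max\{1,r\}\sqrt T)$ in $T$ and $r$: there are $K,p$, independent of $T$ and $r$, such that $|B^P(T,r)|\le K\max\{1,r\}\sqrt T\,\log^p(2+T+r)$ for all integers $T\ge1$ and all real $r\ge0$. 2. $B^P$ is an expected regret bound for DECO-EF with potential $F^P$: if $0<\gamma\le\min\Big\{1,\frac{1-\sqrt\alpha}{2\sqrt\alpha(1+4/\mu)+\mu/2}\Big\}$, $\bar\eta=1-\gamma\mu/2$, and $q(t)=\lceil ct\rceil$ with $c\ge-\frac{2\log2}{\log\bar\eta}$ for KT, respectively $c\ge-\frac{3}{2\log\bar\eta}$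 for SE, then for every $u\in\mathcal H$ and every integer $T\ge1$ the random variable $R_T^{\mathrm{net}}(u)$ is integrable and $\mathbb E R_T^{\mathrm{net}}(u)\le B^P(T,\|u\|)$. Consequently $\mathbb E R_T^{\mathrm{net}}(u)$ is at most $\widetilde O(\max\{1,\|u\|\}\sqrt T)$ for both potentials. -/

import Mathlib

open MeasureTheory ProbabilityTheory
open scoped RealInnerProductSpace

noncomputable section

namespace DecoEF

/-! ## Coin-betting potentials and predictions -/

/-- The two potentials: Krichevsky-Trofimov and shifted-exponential. -/
inductive Potential where
  | KT : Potential
  | SE : Potential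

/-- The potential functions `F_t(x)` with endowment `ε`. -/
def Potential.fn (ε : ℝ) : Potential → ℕ → ℝ → ℝ
  | .KT, t, x =>
      ε * (2 ^ t * Real.Gamma (((t : ℝ) + 1) / 2 + x / 2) *
        Real.Gamma (((t : ℝ) + 1) / 2 - x / 2)) / (Real.pi * (t.factorial : ℝ))
  | .SE, t, x =>
      ε / Real.sqrt ((t : ℝ) + 1) * Real.exp (x ^ 2 / (2 * ((t : ℝ) + 1)))

/-- Betting fraction `β_t(x)`. -/
def bettingFraction (F : ℕ → ℝ → ℝ) (t : ℕ) (x : ℝ) : ℝ :=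
  (F t (x + 1) - F t (x - 1)) / (F t (x + 1) + F t (x - 1))

/-- Coin-betting function `h_t(x) = β_t(x) F_{t-1}(x)`; only used for `t ≥ 1`. -/
def coinBet (F : ℕ → ℝ → ℝ) (t : ℕ) (x : ℝ) : ℝ :=
  bettingFraction F t x * F (t - 1) x

variable {H : Type*} [NormedAddCommGroup H] [InnerProductSpace ℝ H]

open Classical in
/-- Radial lift `Bet_t` of `h_t` to a Hilbert space. -/
def bet (F : ℕ → ℝ → ℝ) (t : ℕ) (G : H) : H :=
  if G = 0 then 0 else (coinBet F t ‖G‖ / ‖G‖) • G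

open Classical in
/-- Norm clipping at radius `R`. -/
def clip (R : ℝ) (G : H) : H :=
  if ‖G‖ ≤ R then G else (R / ‖G‖) • G

/-! ## Network and compressor -/

/-- Product network norm on `H^N`. -/
def networkNorm {N : ℕ} (Z : Fin N → H) : ℝ :=
  Real.sqrt (∑ n, ‖Z n‖ ^ 2)

/-- Valid gossip matrix for the communication graph `𝒢`. -/
structure IsGossipMatrix {N : ℕ} (𝒢 : SimpleGraph (Fin N))
    (W : Matrix (Fin N) (Fin N) ℝ) : Prop where
  doublyStochastic : W ∈ doublyStochastic ℝ (Fin N)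
  symm : W.IsSymm
  pos_of_adj : ∀ i j, 𝒢.Adj i j → 0 < W i j
  zero_of_not_adj : ∀ i j, i ≠ j → ¬ 𝒢.Adj i j → W i j = 0
  self_pos : ∀ i, 0 < W i i

/-- `ρ ∈ [0,1)` is a contraction factor of `W` on the zero-mean vectors of `H^N`. -/
structure IsContractionFactor (H : Type*) [NormedAddCommGroup H] [InnerProductSpace ℝ H]
    {N : ℕ} (W : Matrix (Fin N) (Fin N) ℝ) (ρ : ℝ) : Prop where
  nonneg : 0 ≤ ρ
  lt_one : ρ < 1
  contracts : ∀ Z : Fin N → H, ∑ n, Z n = 0 →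
    networkNorm (fun n => ∑ j, W n j • Z j) ≤ ρ * networkNorm Z

/-- Randomized compressor with mean-square residual parameter `α`.  The measurability field is
joint Borel measurability of `(ω, v) ↦ C ω v` when `H` is separable; in general it is asked on
every separable set of inputs. -/
structure IsCompressor [MeasurableSpace H] {Ω : Type*} [MeasurableSpace Ω] (ν : Measure Ω)
    (C : Ω → H → H) (α : ℝ) : Prop where
  nonneg : 0 ≤ α
  lt_one : α < 1
  measurable : ∀ s : Set H, TopologicalSpace.IsSeparable s →
    StronglyMeasurable (fun p : Ω × s => C p.1 (p.2 : H))
  residual : ∀ v : H, ∫⁻ ω, ‖C ω v - v‖ₑ ^ 2 ∂ν ≤ ENNReal.ofReal α * ‖v‖ₑ ^ 2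

/-! ## The algorithm, along one realization -/

variable {N : ℕ} {Ω : Type*}

/-- One compressed gossip substep applied to a pair (clean states, trackers); `w n` is the
compressor randomness of Agent `n`. -/
def gossipStep (W : Matrix (Fin N) (Fin N) ℝ) (γ : ℝ) (C : Ω → H → H) (w : Fin N → Ω)
    (S : (Fin N → H) × (Fin N → H)) : (Fin N → H) × (Fin N → H) :=
  let Zhat : Fin N → H := fun n => S.2 n + C (w n) (S.1 n - S.2 n)
  (fun n => S.1 n + γ • ∑ j, W n j • (Zhat j - Zhat n), Zhat)

/-- The result of the first `k` gossip substeps of a round. -/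
def gossipLoop (W : Matrix (Fin N) (Fin N) ℝ) (γ : ℝ) (C : Ω → H → H) (w : ℕ → Fin N → Ω)
    (S : (Fin N → H) × (Fin N → H)) : ℕ → (Fin N → H) × (Fin N → H)
  | 0 => S
  | k + 1 => gossipStep W γ C (w k) (gossipLoop W γ C w S k)

/-- The state `(G_t, Ĝ_t)` at the start of round `t`, given the gradients `g` that were observed
and the compressor randomness `w t k n` of round `t`, substep `k`, Agent `n`. -/
def state (W : Matrix (Fin N) (Fin N) ℝ) (γ : ℝ) (C : Ω → H → H) (q : ℕ → ℕ)
    (w : ℕ → ℕ → Fin N → Ω) (g : ℕ → Fin N → H) : ℕ → (Fin N → H) × (Fin N → H)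
  | 0 => (0, 0)
  | t + 1 =>
      gossipLoop W γ C (w t)
        (fun n => (state W γ C q w g t).1 n - g t n, (state W γ C q w g t).2) (q t)

/-- The prediction `x_{n,t} = Bet_{t+1}(clip_t(G_{n,t}))`. -/
def prediction (F : ℕ → ℝ → ℝ) (W : Matrix (Fin N) (Fin N) ℝ) (γ : ℝ) (C : Ω → H → H)
    (q : ℕ → ℕ) (w : ℕ → ℕ → Fin N → Ω) (g : ℕ → Fin N → H) (t : ℕ) (n : Fin N) : H :=
  bet F (t + 1) (clip (t : ℝ) ((state W γ C q w g t).1 n))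

/-- The network loss at a point. -/
def networkLoss (ℓ : Fin N → H → ℝ) (x : H) : ℝ :=
  (∑ n, ℓ n x) / (N : ℝ)

/-- The network regret of the predictions `x` against the comparator `u` after `T` rounds. -/
def networkRegret (ℓ : ℕ → Fin N → H → ℝ) (x : ℕ → Fin N → H) (u : H) (T : ℕ) : ℝ :=
  ∑ t ∈ Finset.range T, (∑ n, networkLoss (ℓ t) (x t n)) / (N : ℝ)
    - ∑ t ∈ Finset.range T, networkLoss (ℓ t) u

/-! ## Randomness and feedback -/

variable {Ω₀ : Type*} [MeasurableSpace Ω]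

/-- The compressor randomness `ξ t k n` (round, substep, agent) is fresh: each draw has law `ν`,
and the draws of different substeps are independent.  Nothing is asked about the dependence
between agents inside one substep. -/
structure IsFresh [MeasurableSpace Ω₀] (P : Measure Ω₀) (ν : Measure Ω)
    (ξ : ℕ → ℕ → Fin N → Ω₀ → Ω) : Prop where
  measurable : ∀ t k n, Measurable (ξ t k n)
  law : ∀ t k n, P.map (ξ t k n) = ν
  indep : iIndepFun (fun (p : ℕ × ℕ) (ω : Ω₀) (n : Fin N) => ξ p.1 p.2 n ω) P

/-- The history before round `t`: everything generated by the compressor randomness of the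
earlier rounds. -/
@[reducible] def history (ξ : ℕ → ℕ → Fin N → Ω₀ → Ω) (t : ℕ) : MeasurableSpace Ω₀ :=
  ⨆ (s : ℕ) (_ : s < t) (k : ℕ) (n : Fin N), MeasurableSpace.comap (ξ s k n) inferInstance

/-- `g` is a subgradient of `f` at `x`. -/
def IsSubgradient (f : H → ℝ) (x g : H) : Prop :=
  ∀ y, f x + ⟪g, y - x⟫ ≤ f y

/-- Convex `1`-Lipschitz losses, chosen possibly adaptively from the history. -/
structure IsLossSequence (ξ : ℕ → ℕ → Fin N → Ω₀ → Ω)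
    (ℓ : ℕ → Fin N → Ω₀ → H → ℝ) : Prop where
  measurable : ∀ t n x, Measurable[history ξ t] (fun ω => ℓ t n ω x)
  convex : ∀ t n ω, ConvexOn ℝ Set.univ (ℓ t n ω)
  lipschitz : ∀ t n ω, LipschitzWith 1 (ℓ t n ω)

/-- The gradients `g` are subgradients of the local losses at the predictions of the run that
they generate; the choice of the subgradient is measurable with respect to the history. -/
structure IsRun (F : ℕ → ℝ → ℝ) (W : Matrix (Fin N) (Fin N) ℝ) (γ : ℝ) (C : Ω → H → H)
    (q : ℕ → ℕ) (ξ : ℕ → ℕ → Fin N → Ω₀ → Ω) (ℓ : ℕ → Fin N → Ω₀ → H → ℝ)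
    (g : ℕ → Fin N → Ω₀ → H) : Prop where
  measurable : ∀ t n, StronglyMeasurable[history ξ t] (g t n)
  subgradient : ∀ t n ω, IsSubgradient (ℓ t n ω)
    (prediction F W γ C q (fun t k n => ξ t k n ω) (fun t n => g t n ω) t n) (g t n ω)

/-- The network regret of a run, as a random variable. -/
def runRegret (F : ℕ → ℝ → ℝ) (W : Matrix (Fin N) (Fin N) ℝ) (γ : ℝ) (C : Ω → H → H)
    (q : ℕ → ℕ) (ξ : ℕ → ℕ → Fin N → Ω₀ → Ω) (ℓ : ℕ → Fin N → Ω₀ → H → ℝ)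
    (g : ℕ → Fin N → Ω₀ → H) (u : H) (T : ℕ) (ω : Ω₀) : ℝ :=
  networkRegret (fun t n => ℓ t n ω)
    (prediction F W γ C q (fun t k n => ξ t k n ω) (fun t n => g t n ω)) u T

/-! ## Parameters and closed-form bounds -/

/-- Largest admissible communication step size, for spectral gap `μ`. -/
def maxStepSize (α μ : ℝ) : ℝ :=
  min 1 ((1 - Real.sqrt α) / (2 * Real.sqrt α * (1 + 4 / μ) + μ / 2))

/-- Smallest admissible constant of the linear gossip schedule, for effective rate `η`. -/
def Potential.minSchedule : Potential → ℝ → ℝ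
  | .KT, η => -(2 * Real.log 2) / Real.log η
  | .SE, η => -3 / (2 * Real.log η)

/-- The linear gossip schedule `q(t) = ⌈c t⌉`. -/
def linearSchedule (c : ℝ) (t : ℕ) : ℕ := ⌈c * (t : ℝ)⌉₊

/-- The schedule constant `C_sched`. -/
def Potential.schedConst (ε : ℝ) : Potential → ℝ
  | .KT => 48 * ((ε + 1) * (1 + 2 / Real.log 2) + 1)
  | .SE => 4 * Real.exp (3 / 2) * (2 * ε + 1)

/-- The regret constant `C_reg = 3 (2 + μ/4) (C_sched / 2) √N`. -/
def Potential.regConst (P : Potential) (ε : ℝ) (N : ℕ) (μ : ℝ) : ℝ :=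
  3 * ((2 + μ / 4) * (P.schedConst ε / 2) * Real.sqrt N)

/-- The closed-form regret bound as a function of the horizon `T` and of `r = ‖u‖`. -/
def Potential.closedForm (ε : ℝ) (N : ℕ) (μ : ℝ) : Potential → ℕ → ℝ → ℝ
  | .KT, T, r =>
      r * Real.sqrt (2 * ((T : ℝ) + 1)) *
          Real.sqrt (Real.log
            (1 + 2 * Real.exp 1 ^ 2 * Real.pi * (T : ℝ) * ((T : ℝ) + 1) * r ^ 2 / ε ^ 2))
        + ε * (1 - 1 / (Real.exp 1 * Real.sqrt (Real.pi * (T : ℝ))))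
        + Potential.KT.regConst ε N μ * Real.sqrt T
  | .SE, T, r =>
      r * Real.sqrt (((T : ℝ) + 1) *
          Real.log (1 + ((T : ℝ) + 1) ^ 2 * r ^ 2 / ε ^ 2))
        + ε * (1 - 1 / Real.sqrt ((T : ℝ) + 1))
        + Potential.SE.regConst ε N μ * Real.sqrt T

/-- `B = Õ(S)` for functions of `T ≥ 1` and `r ≥ 0`: up to a constant, `B` is at most `S` times a
power of the logarithm, uniformly in `T` and `r`. -/
def IsSoftO (B S : ℕ → ℝ → ℝ) : Prop :=
  ∃ (K : ℝ) (p : ℕ), ∀ T : ℕ, 1 ≤ T → ∀ r : ℝ, 0 ≤ r →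
    |B T r| ≤ K * |S T r| * Real.log (2 + (T : ℝ) + r) ^ p

end DecoEF

end

/-! The regret splits into that of one ideal centralised coin bettor and the price of imperfect
consensus. Since `W` is doubly stochastic, every compressed gossip step changes the states by a
vector of zero sum. Hence the network mean of the states is exactly minus the sum of the mean
gradients, whatever the compressor does (`IsGossipMatrix.mean_state`), and this mean is the state of
a bettor whose coins lie in the unit ball.

For the ideal bettor, each bet earns at least the increase of `F_t(‖G_t‖)`
(`Potential.fn_succ_norm_add_le`). The passage from scalars to a Hilbert space rests on convexity of
`z ↦ F_t(√z)`, which for KT comes from Euler's limit formula for Gamma. Telescoping bounds the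
wealth from below by `F_T`; a Gaussian minorant of `F_T` and its convex conjugate turn wealth into
regret.

For consensus, the prediction map is Lipschitz with a constant growing like `2^t` (KT) or `e^{t/2}`
(SE). The mean-square consensus error plus `μ/4` times the mean-square tracking error contracts by
`1 - γμ/2` in each substep (`IsGossipMatrix.lyapunovBound_gossipStep`). A linear number of substeps
makes the error of order `4^{-t}` or `e^{-3t/2}`, which beats the Lipschitz growth, so the weighted
errors have a sum bounded independently of `T`.

A contraction factor exists by a Poincaré inequality: on a connected graph the energy lost in one
mixing step controls all pairwise differences. -/

noncomputable section

set_option linter.unusedSectionVars false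

namespace DecoEF

/-! ### Network norm, averaging, and the spectral gap of the gossip matrix. -/

section Network

variable {H : Type*} [NormedAddCommGroup H] [InnerProductSpace ℝ H] {N : ℕ}

theorem networkNorm_eq_norm_toLp (Z : Fin N → H) : networkNorm Z = ‖WithLp.toLp 2 Z‖ := by
  rw [PiLp.norm_eq_of_L2]
  rfl

theorem networkNorm_nonneg (Z : Fin N → H) : 0 ≤ networkNorm Z := Real.sqrt_nonneg _

theorem networkNorm_sq (Z : Fin N → H) : networkNorm Z ^ 2 = ∑ n, ‖Z n‖ ^ 2 :=
  Real.sq_sqrt (Finset.sum_nonneg fun _ _ => sq_nonneg _)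

theorem networkNorm_add_le (Y Z : Fin N → H) :
    networkNorm (Y + Z) ≤ networkNorm Y + networkNorm Z := by
  simpa only [networkNorm_eq_norm_toLp, WithLp.toLp_add] using norm_add_le _ _

theorem networkNorm_sub_le (Y Z : Fin N → H) :
    networkNorm (Y - Z) ≤ networkNorm Y + networkNorm Z := by
  simpa only [networkNorm_eq_norm_toLp, WithLp.toLp_sub] using norm_sub_le _ _

theorem networkNorm_smul (a : ℝ) (Z : Fin N → H) : networkNorm (a • Z) = |a| * networkNorm Z := by
  simp only [networkNorm_eq_norm_toLp, WithLp.toLp_smul, norm_smul, Real.norm_eq_abs]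

theorem networkNorm_le_of_forall_le {Z : Fin N → H} {b : ℝ} (hb : 0 ≤ b) (h : ∀ n, ‖Z n‖ ≤ b) :
    networkNorm Z ≤ b * Real.sqrt N := by
  rw [networkNorm, ← Real.sqrt_sq hb, ← Real.sqrt_mul (sq_nonneg b)]
  apply Real.sqrt_le_sqrt
  calc ∑ n, ‖Z n‖ ^ 2 ≤ ∑ _n : Fin N, b ^ 2 :=
        Finset.sum_le_sum fun n _ => pow_le_pow_left₀ (norm_nonneg _) (h n) 2
    _ = b ^ 2 * N := by simp [mul_comm]

theorem sum_norm_le_sqrt_mul_networkNorm (Z : Fin N → H) :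
    ∑ n, ‖Z n‖ ≤ Real.sqrt N * networkNorm Z := by
  rw [networkNorm, ← Real.sqrt_mul (Nat.cast_nonneg N)]
  apply Real.le_sqrt_of_sq_le
  simpa using sq_sum_le_card_mul_sum_sq (s := (Finset.univ : Finset (Fin N))) (f := fun n => ‖Z n‖)

/-- Mixing by `W`, as a linear map of `H^N`. -/
def mix (H : Type*) [NormedAddCommGroup H] [InnerProductSpace ℝ H]
    (W : Matrix (Fin N) (Fin N) ℝ) : (Fin N → H) →ₗ[ℝ] (Fin N → H) where
  toFun Z n := ∑ j, W n j • Z j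
  map_add' Y Z := by
    funext n
    simp [smul_add, Finset.sum_add_distrib]
  map_smul' a Z := by
    funext n
    simp [Finset.smul_sum, smul_comm a]

theorem mix_apply (W : Matrix (Fin N) (Fin N) ℝ) (Z : Fin N → H) (n : Fin N) :
    mix H W Z n = ∑ j, W n j • Z j := rfl

/-- The network average. -/
def mean (Z : Fin N → H) : H := (N : ℝ)⁻¹ • ∑ n, Z n

/-- Deviation from the network average. -/
def dev (Z : Fin N → H) : Fin N → H := fun n => Z n - mean Z

theorem mean_sub (Y Z : Fin N → H) : mean (Y - Z) = mean Y - mean Z := by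
  simp [mean, Finset.sum_sub_distrib, smul_sub]

theorem dev_sub (Y Z : Fin N → H) : dev (Y - Z) = dev Y - dev Z := by
  funext n
  simp only [dev, mean_sub, Pi.sub_apply]
  abel

theorem norm_mean_le_of_forall_le {Z : Fin N → H} {b : ℝ} (hb : 0 ≤ b) (h : ∀ n, ‖Z n‖ ≤ b) :
    ‖mean Z‖ ≤ b := by
  rw [mean, norm_smul, norm_inv, Real.norm_natCast]
  rcases Nat.eq_zero_or_pos N with rfl | hN
  · simpa using hb
  rw [inv_mul_le_iff₀ (by exact_mod_cast hN)]
  calc ‖∑ n, Z n‖ ≤ ∑ _n : Fin N, b := norm_sum_le_of_le _ fun n _ => h n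
    _ = N * b := by simp

theorem sum_dev (Z : Fin N → H) : ∑ n, dev Z n = 0 := by
  rcases Nat.eq_zero_or_pos N with rfl | hN
  · simp
  have : (N : ℝ) ≠ 0 := by positivity
  simp only [dev, Finset.sum_sub_distrib, Finset.sum_const, Finset.card_univ, Fintype.card_fin,
    mean]
  rw [← Nat.cast_smul_eq_nsmul ℝ, smul_smul, mul_inv_cancel₀ this, one_smul, sub_self]

theorem networkNorm_dev_le_of_forall_le {Z : Fin N → H} {b : ℝ} (hb : 0 ≤ b)
    (h : ∀ n, ‖Z n‖ ≤ b) : networkNorm (dev Z) ≤ 2 * b * Real.sqrt N := by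
  apply networkNorm_le_of_forall_le (by positivity)
  intro n
  calc ‖Z n - mean Z‖ ≤ ‖Z n‖ + ‖mean Z‖ := norm_sub_le _ _
    _ ≤ b + b := add_le_add (h n) (norm_mean_le_of_forall_le hb h)
    _ = 2 * b := by ring

/-- Variance identity for an affine combination. -/
theorem norm_sum_smul_sq {ι : Type*} [Fintype ι] (w : ι → ℝ) (hw : ∑ i, w i = 1) (Z : ι → H) :
    ‖∑ i, w i • Z i‖ ^ 2
      = ∑ i, w i * ‖Z i‖ ^ 2 - 1 / 2 * ∑ i, ∑ j, w i * w j * ‖Z i - Z j‖ ^ 2 := by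
  have h1 : ∑ i, ∑ j, w i * w j * ‖Z i‖ ^ 2 = ∑ i, w i * ‖Z i‖ ^ 2 := by
    refine Finset.sum_congr rfl fun i _ => ?_
    rw [← Finset.sum_mul, ← Finset.mul_sum, hw, mul_one]
  have h2 : ∑ i, ∑ j, w i * w j * ‖Z j‖ ^ 2 = ∑ i, w i * ‖Z i‖ ^ 2 := by
    rw [Finset.sum_comm, ← h1]
    exact Finset.sum_congr rfl fun i _ => Finset.sum_congr rfl fun j _ => by ring
  have h3 : ‖∑ i, w i • Z i‖ ^ 2 = ∑ i, ∑ j, w i * w j * ⟪Z i, Z j⟫ := by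
    rw [← real_inner_self_eq_norm_sq, sum_inner]
    refine Finset.sum_congr rfl fun i _ => ?_
    rw [inner_sum]
    refine Finset.sum_congr rfl fun j _ => ?_
    rw [real_inner_smul_left, real_inner_smul_right]
    ring
  have h4 : ∑ i, ∑ j, w i * w j * ‖Z i - Z j‖ ^ 2
      = ∑ i, ∑ j, w i * w j * ‖Z i‖ ^ 2 - 2 * ∑ i, ∑ j, w i * w j * ⟪Z i, Z j⟫
        + ∑ i, ∑ j, w i * w j * ‖Z j‖ ^ 2 := by
    simp only [Finset.mul_sum, ← Finset.sum_sub_distrib, ← Finset.sum_add_distrib]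
    refine Finset.sum_congr rfl fun i _ => Finset.sum_congr rfl fun j _ => ?_
    rw [norm_sub_sq_real]
    ring
  rw [h4, h1, h2, h3]
  ring

/-- The Dirichlet form of `W`, up to a factor. -/
def dirichlet (W : Matrix (Fin N) (Fin N) ℝ) (Z : Fin N → H) : ℝ :=
  ∑ n, ∑ i, ∑ j, W n i * W n j * ‖Z i - Z j‖ ^ 2

section Gossip

variable {𝒢 : SimpleGraph (Fin N)} {W : Matrix (Fin N) (Fin N) ℝ}

theorem IsGossipMatrix.nonneg (hW : IsGossipMatrix 𝒢 W) (i j : Fin N) : 0 ≤ W i j :=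
  (mem_doublyStochastic_iff_sum.1 hW.doublyStochastic).1 i j

theorem IsGossipMatrix.sum_row (hW : IsGossipMatrix 𝒢 W) (i : Fin N) : ∑ j, W i j = 1 :=
  (mem_doublyStochastic_iff_sum.1 hW.doublyStochastic).2.1 i

theorem IsGossipMatrix.sum_col (hW : IsGossipMatrix 𝒢 W) (j : Fin N) : ∑ i, W i j = 1 :=
  (mem_doublyStochastic_iff_sum.1 hW.doublyStochastic).2.2 j

/-- The variance identity is applied to each row and summed over rows. Column sums equal to one turn
the weighted squares back into the full norm, so the loss of energy is exactly half the Dirichlet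
form. -/
theorem IsGossipMatrix.networkNorm_mix_sq (hW : IsGossipMatrix 𝒢 W) (Z : Fin N → H) :
    networkNorm (mix H W Z) ^ 2 = networkNorm Z ^ 2 - 1 / 2 * dirichlet W Z := by
  simp only [networkNorm_sq, mix_apply, norm_sum_smul_sq _ (hW.sum_row _)]
  rw [Finset.sum_sub_distrib, Finset.sum_comm, ← Finset.mul_sum, dirichlet]
  congr 1
  refine Finset.sum_congr rfl fun j _ => ?_
  rw [← Finset.sum_mul, hW.sum_col, one_mul]

theorem IsGossipMatrix.term_nonneg (hW : IsGossipMatrix 𝒢 W) (Z : Fin N → H) (n i j : Fin N) :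
    0 ≤ W n i * W n j * ‖Z i - Z j‖ ^ 2 :=
  mul_nonneg (mul_nonneg (hW.nonneg _ _) (hW.nonneg _ _)) (sq_nonneg _)

theorem IsGossipMatrix.term_le_dirichlet (hW : IsGossipMatrix 𝒢 W) (Z : Fin N → H)
    (n i j : Fin N) : W n i * W n j * ‖Z i - Z j‖ ^ 2 ≤ dirichlet W Z := by
  have h := hW.term_nonneg Z
  calc W n i * W n j * ‖Z i - Z j‖ ^ 2
      ≤ ∑ j, W n i * W n j * ‖Z i - Z j‖ ^ 2 :=
        Finset.single_le_sum (f := fun j => W n i * W n j * ‖Z i - Z j‖ ^ 2)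
          (fun j _ => h n i j) (Finset.mem_univ j)
    _ ≤ ∑ i, ∑ j, W n i * W n j * ‖Z i - Z j‖ ^ 2 :=
        Finset.single_le_sum (f := fun i => ∑ j, W n i * W n j * ‖Z i - Z j‖ ^ 2)
          (fun i _ => Finset.sum_nonneg fun j _ => h n i j) (Finset.mem_univ i)
    _ ≤ dirichlet W Z :=
        Finset.single_le_sum (f := fun n => ∑ i, ∑ j, W n i * W n j * ‖Z i - Z j‖ ^ 2)
          (fun n _ => Finset.sum_nonneg fun i _ => Finset.sum_nonneg fun j _ => h n i j)
          (Finset.mem_univ n)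

theorem IsGossipMatrix.dirichlet_nonneg (hW : IsGossipMatrix 𝒢 W) (Z : Fin N → H) :
    0 ≤ dirichlet W Z :=
  Finset.sum_nonneg fun n _ => Finset.sum_nonneg fun i _ => Finset.sum_nonneg fun j _ =>
    hW.term_nonneg Z n i j

theorem IsGossipMatrix.networkNorm_mix_le (hW : IsGossipMatrix 𝒢 W) (Z : Fin N → H) :
    networkNorm (mix H W Z) ≤ networkNorm Z := by
  apply le_of_sq_le_sq _ (networkNorm_nonneg Z)
  rw [hW.networkNorm_mix_sq]
  linarith [hW.dirichlet_nonneg Z]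

-- For an edge `i j` the Dirichlet form contains the term at row `i` with weight `W i i * W i j`;
-- the positive diagonal makes that weight positive. The triangle inequality adds these estimates
-- along the walk, with `K` independent of `Z`.
variable (H) in
theorem IsGossipMatrix.exists_norm_sub_le (hW : IsGossipMatrix 𝒢 W) {i j : Fin N}
    (p : 𝒢.Walk i j) :
    ∃ K : ℝ, 0 ≤ K ∧ ∀ Z : Fin N → H, ‖Z i - Z j‖ ≤ K * Real.sqrt (dirichlet W Z) := by
  induction p with
  | nil => exact ⟨0, le_rfl, fun Z => by simp⟩
  | @cons i j k hij _ ih =>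
    obtain ⟨K, hK, h⟩ := ih
    have hm : 0 < W i i * W i j := mul_pos (hW.self_pos i) (hW.pos_of_adj i j hij)
    refine ⟨(Real.sqrt (W i i * W i j))⁻¹ + K, by positivity, fun Z => ?_⟩
    have h1 : ‖Z i - Z j‖ ≤ (Real.sqrt (W i i * W i j))⁻¹ * Real.sqrt (dirichlet W Z) := by
      rw [← Real.sqrt_inv, ← Real.sqrt_mul (inv_nonneg.2 hm.le)]
      apply Real.le_sqrt_of_sq_le
      rw [le_inv_mul_iff₀ hm]
      exact hW.term_le_dirichlet Z i i j
    calc ‖Z i - Z k‖ ≤ ‖Z i - Z j‖ + ‖Z j - Z k‖ := norm_sub_le_norm_sub_add_norm_sub _ _ _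
      _ ≤ _ := by rw [add_mul]; exact add_le_add h1 (h Z)

/-- This is the variance identity with uniform weights `1/N`, where the barycentre vanishes. -/
theorem networkNorm_sq_of_sum_eq_zero (hN : 0 < N) (Z : Fin N → H) (hZ : ∑ n, Z n = 0) :
    networkNorm Z ^ 2 = 1 / (2 * N) * ∑ i, ∑ j, ‖Z i - Z j‖ ^ 2 := by
  have hN' : (N : ℝ) ≠ 0 := by positivity
  have h := norm_sum_smul_sq (fun _ : Fin N => (N : ℝ)⁻¹) (by simp [hN']) Z
  rw [← Finset.smul_sum, hZ, smul_zero, norm_zero] at h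
  simp only [← Finset.mul_sum, mul_assoc] at h
  rw [networkNorm_sq]
  field_simp at h ⊢
  linarith

variable (H) in
/-- A gossip matrix on a connected graph has a contraction factor. -/
theorem IsGossipMatrix.exists_isContractionFactor (hW : IsGossipMatrix 𝒢 W)
    (h𝒢 : 𝒢.Connected) : ∃ ρ, IsContractionFactor H W ρ := by
  have hN : 0 < N := by
    obtain ⟨⟨n⟩⟩ := h𝒢.nonempty
    omega
  have hK : ∀ i j, ∃ K : ℝ, 0 ≤ K ∧
      ∀ Z : Fin N → H, ‖Z i - Z j‖ ≤ K * Real.sqrt (dirichlet W Z) := fun i j =>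
    hW.exists_norm_sub_le H (h𝒢.preconnected i j).some
  choose K hK0 hK using hK
  -- `κ` is a Poincaré constant: zero-mean vectors satisfy `‖Z‖² ≤ κ * dirichlet W Z`. The energy
  -- identity then gives `ρ² = 1 - 1/(2κ)`; the added `1` keeps this in `[0,1)`.
  set κ : ℝ := 1 + 1 / (2 * N) * ∑ i, ∑ j, K i j ^ 2 with hκ
  have hκ1 : 1 ≤ κ := by
    have : 0 ≤ 1 / (2 * (N : ℝ)) * ∑ i, ∑ j, K i j ^ 2 := by positivity
    linarith
  have hκ2 : 0 < 1 / (2 * κ) ∧ 1 / (2 * κ) ≤ 1 := by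
    refine ⟨by positivity, ?_⟩
    rw [div_le_one (by positivity)]
    linarith
  refine ⟨Real.sqrt (1 - 1 / (2 * κ)), Real.sqrt_nonneg _, ?_, fun Z hZ => ?_⟩
  · rw [Real.sqrt_lt' one_pos]
    linarith [hκ2.1]
  · have hE := hW.dirichlet_nonneg Z
    have h1 : networkNorm Z ^ 2 ≤ κ * dirichlet W Z := by
      rw [networkNorm_sq_of_sum_eq_zero hN Z hZ]
      have : ∑ i, ∑ j, ‖Z i - Z j‖ ^ 2 ≤ (∑ i, ∑ j, K i j ^ 2) * dirichlet W Z := by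
        simp only [Finset.sum_mul]
        refine Finset.sum_le_sum fun i _ => Finset.sum_le_sum fun j _ => ?_
        calc ‖Z i - Z j‖ ^ 2 ≤ (K i j * Real.sqrt (dirichlet W Z)) ^ 2 :=
              pow_le_pow_left₀ (norm_nonneg _) (hK i j Z) 2
          _ = _ := by rw [mul_pow, Real.sq_sqrt hE]
      calc _ ≤ 1 / (2 * (N : ℝ)) * ((∑ i, ∑ j, K i j ^ 2) * dirichlet W Z) := by gcongr
        _ ≤ κ * dirichlet W Z := by rw [hκ, ← mul_assoc]; gcongr; linarith
    apply le_of_sq_le_sq _ (mul_nonneg (Real.sqrt_nonneg _) (networkNorm_nonneg Z))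
    rw [mul_pow, Real.sq_sqrt (by linarith [hκ2.2])]
    have h2 : networkNorm (fun n => ∑ j, W n j • Z j) ^ 2
      = networkNorm Z ^ 2 - 1 / 2 * dirichlet W Z := hW.networkNorm_mix_sq Z
    rw [h2]
    have h3 : 1 / (2 * κ) * networkNorm Z ^ 2 ≤ 1 / 2 * dirichlet W Z := by
      rw [div_mul_eq_mul_div, one_mul, div_le_iff₀ (by positivity)]
      linarith
    linarith

/-! ### One compressed gossip substep -/

variable {Ω : Type*} {γ ρ : ℝ}

/-- Compression residual of a substep. -/
def compressionResidual (C : Ω → H → H) (w : Fin N → Ω) (S : (Fin N → H) × (Fin N → H)) :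
    Fin N → H :=
  fun n => (S.1 n - S.2 n) - C (w n) (S.1 n - S.2 n)

/-- The new tracker is the clean state minus the compression residual. A compressed substep is thus
a gossip step whose increment `W - I` is evaluated at a perturbed vector. -/
theorem IsGossipMatrix.gossipStep_fst (hW : IsGossipMatrix 𝒢 W) (C : Ω → H → H)
    (w : Fin N → Ω) (S : (Fin N → H) × (Fin N → H)) :
    (gossipStep W γ C w S).1
      = S.1 + γ • (mix H W (S.1 - compressionResidual C w S) - (S.1 - compressionResidual C w S)) := by
  have h : S.1 - compressionResidual C w S = fun n => S.2 n + C (w n) (S.1 n - S.2 n) := by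
    funext n
    simp only [compressionResidual, Pi.sub_apply]
    abel
  rw [h]
  funext n
  simp only [gossipStep, Pi.add_apply, Pi.smul_apply, Pi.sub_apply, mix_apply]
  congr 2
  simp only [smul_sub (W n _), Finset.sum_sub_distrib, ← Finset.sum_smul, hW.sum_row, one_smul]

theorem gossipStep_snd (C : Ω → H → H) (w : Fin N → Ω) (S : (Fin N → H) × (Fin N → H)) :
    (gossipStep W γ C w S).2 = S.1 - compressionResidual C w S := by
  funext n
  simp only [gossipStep, compressionResidual, Pi.sub_apply]
  abel

theorem IsGossipMatrix.sum_mix (hW : IsGossipMatrix 𝒢 W) (Z : Fin N → H) :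
    ∑ n, mix H W Z n = ∑ n, Z n := by
  simp only [mix_apply]
  rw [Finset.sum_comm]
  simp only [← Finset.sum_smul, hW.sum_col, one_smul]

/-- The increment lies in the range of `W - I`, whose components sum to zero because columns sum to
one. Compression errors therefore never reach the mean. -/
theorem IsGossipMatrix.mean_gossipStep (hW : IsGossipMatrix 𝒢 W) (C : Ω → H → H)
    (w : Fin N → Ω) (S : (Fin N → H) × (Fin N → H)) :
    mean (gossipStep W γ C w S).1 = mean S.1 := by
  rw [hW.gossipStep_fst, mean, mean]
  simp only [Pi.add_apply, Pi.smul_apply, Pi.sub_apply, Finset.sum_add_distrib,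
    ← Finset.smul_sum, Finset.sum_sub_distrib, hW.sum_mix, sub_self, smul_zero, add_zero]

theorem IsGossipMatrix.mix_dev_sub (hW : IsGossipMatrix 𝒢 W) (Z : Fin N → H) :
    mix H W (dev Z) - dev Z = mix H W Z - Z := by
  funext n
  simp only [mix_apply, Pi.sub_apply, dev, smul_sub, Finset.sum_sub_distrib, ← Finset.sum_smul,
    hW.sum_row, one_smul]
  abel

theorem IsGossipMatrix.dev_gossipStep (hW : IsGossipMatrix 𝒢 W) (C : Ω → H → H)
    (w : Fin N → Ω) (S : (Fin N → H) × (Fin N → H)) :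
    dev (gossipStep W γ C w S).1 = (1 - γ) • dev S.1 + γ • mix H W (dev S.1)
      - γ • (mix H W (compressionResidual C w S) - compressionResidual C w S) := by
  have h : dev (gossipStep W γ C w S).1
      = dev S.1 + γ • (mix H W (S.1 - compressionResidual C w S) - (S.1 - compressionResidual C w S)) := by
    funext n
    simp only [dev, hW.mean_gossipStep, Pi.add_apply]
    rw [hW.gossipStep_fst]
    simp only [Pi.add_apply]
    abel
  rw [h, map_sub, sub_sub_sub_comm, ← hW.mix_dev_sub S.1]
  module

theorem IsGossipMatrix.gossipStep_fst_sub_snd (hW : IsGossipMatrix 𝒢 W) (C : Ω → H → H)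
    (w : Fin N → Ω) (S : (Fin N → H) × (Fin N → H)) :
    (gossipStep W γ C w S).1 - (gossipStep W γ C w S).2 = compressionResidual C w S
      + γ • (mix H W (dev S.1) - dev S.1)
      - γ • (mix H W (compressionResidual C w S) - compressionResidual C w S) := by
  rw [hW.gossipStep_fst, gossipStep_snd, map_sub, sub_sub_sub_comm (mix H W S.1),
    ← hW.mix_dev_sub S.1]
  module

theorem IsGossipMatrix.networkNorm_mix_sub_le (hW : IsGossipMatrix 𝒢 W) (Z : Fin N → H) :
    networkNorm (mix H W Z - Z) ≤ 2 * networkNorm Z := by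
  linarith [networkNorm_sub_le (mix H W Z) Z, hW.networkNorm_mix_le Z]

/-- The exact part contracts by `(1 - γ) + γρ`, and the residual enters through `γ(W - I)`, of norm
at most `2γ`. Together with `networkNorm_gossipStep_sub_le` this is a linear recursion in consensus
and tracking errors. -/
theorem IsGossipMatrix.networkNorm_dev_gossipStep_le (hW : IsGossipMatrix 𝒢 W)
    (hρ : IsContractionFactor H W ρ) (hγ0 : 0 ≤ γ) (hγ1 : γ ≤ 1) (C : Ω → H → H)
    (w : Fin N → Ω) (S : (Fin N → H) × (Fin N → H)) :
    networkNorm (dev (gossipStep W γ C w S).1)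
      ≤ (1 - γ * (1 - ρ)) * networkNorm (dev S.1)
        + 2 * γ * networkNorm (compressionResidual C w S) := by
  rw [hW.dev_gossipStep]
  have h1 := networkNorm_sub_le ((1 - γ) • dev S.1 + γ • mix H W (dev S.1))
    (γ • (mix H W (compressionResidual C w S) - compressionResidual C w S))
  have h2 := networkNorm_add_le ((1 - γ) • dev S.1) (γ • mix H W (dev S.1))
  rw [networkNorm_smul, abs_of_nonneg hγ0] at h1
  rw [networkNorm_smul, networkNorm_smul, abs_of_nonneg hγ0, abs_of_nonneg (by linarith)] at h2
  have h3 := mul_le_mul_of_nonneg_left (hρ.contracts (dev S.1) (sum_dev _)) hγ0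
  change γ * networkNorm (mix H W (dev S.1)) ≤ _ at h3
  have h4 := mul_le_mul_of_nonneg_left (hW.networkNorm_mix_sub_le (compressionResidual C w S)) hγ0
  linarith

theorem IsGossipMatrix.networkNorm_gossipStep_sub_le (hW : IsGossipMatrix 𝒢 W)
    (hγ0 : 0 ≤ γ) (C : Ω → H → H) (w : Fin N → Ω) (S : (Fin N → H) × (Fin N → H)) :
    networkNorm ((gossipStep W γ C w S).1 - (gossipStep W γ C w S).2)
      ≤ 2 * γ * networkNorm (dev S.1)
        + (1 + 2 * γ) * networkNorm (compressionResidual C w S) := by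
  rw [hW.gossipStep_fst_sub_snd]
  have h1 := networkNorm_sub_le (compressionResidual C w S + γ • (mix H W (dev S.1) - dev S.1))
    (γ • (mix H W (compressionResidual C w S) - compressionResidual C w S))
  have h2 := networkNorm_add_le (compressionResidual C w S) (γ • (mix H W (dev S.1) - dev S.1))
  rw [networkNorm_smul, abs_of_nonneg hγ0] at h1 h2
  have h3 := mul_le_mul_of_nonneg_left (hW.networkNorm_mix_sub_le (dev S.1)) hγ0
  have h4 := mul_le_mul_of_nonneg_left (hW.networkNorm_mix_sub_le (compressionResidual C w S)) hγ0
  linarith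

theorem IsGossipMatrix.mean_gossipLoop (hW : IsGossipMatrix 𝒢 W) (C : Ω → H → H)
    (w : ℕ → Fin N → Ω) (S : (Fin N → H) × (Fin N → H)) (k : ℕ) :
    mean (gossipLoop W γ C w S k).1 = mean S.1 := by
  induction k with
  | zero => rfl
  | succ k ih => rw [gossipLoop, hW.mean_gossipStep, ih]

theorem IsGossipMatrix.mean_state (hW : IsGossipMatrix 𝒢 W) (C : Ω → H → H) (q : ℕ → ℕ)
    (w : ℕ → ℕ → Fin N → Ω) (g : ℕ → Fin N → H) (t : ℕ) :
    mean (state W γ C q w g t).1 = -∑ s ∈ Finset.range t, mean (g s) := by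
  induction t with
  | zero => simp [state, mean]
  | succ t ih =>
    rw [state, hW.mean_gossipLoop, Finset.sum_range_succ, neg_add, ← ih, ← sub_eq_add_neg]
    exact mean_sub _ _

end Gossip

end Network

/-! ### Symmetric products of Gamma values -/

/-- The product `Γ(A + y) Γ(A - y)`. -/
def gammaPair (A y : ℝ) : ℝ := Real.Gamma (A + y) * Real.Gamma (A - y)

theorem gammaPair_neg (A y : ℝ) : gammaPair A (-y) = gammaPair A y := by
  rw [gammaPair, gammaPair, sub_neg_eq_add, ← sub_eq_add_neg, mul_comm]

theorem gammaPair_pos {A y : ℝ} (h1 : -A < y) (h2 : y < A) : 0 < gammaPair A y :=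
  mul_pos (Real.Gamma_pos_of_pos (by linarith)) (Real.Gamma_pos_of_pos (by linarith))

theorem gammaPair_sqrt_sq (A y : ℝ) : gammaPair A (Real.sqrt (y ^ 2)) = gammaPair A y := by
  rw [Real.sqrt_sq_eq_abs]
  rcases abs_choice y with h | h <;> rw [h]
  exact gammaPair_neg A y

/-- A product of convex functions is convex when both factors are nonnegative and vary in the same
direction, so the induction must carry all three properties at once. -/
theorem prod_inv_sub_convexOn {A : ℝ} (hA : 0 < A) (n : ℕ) :
    ConvexOn ℝ (Set.Ico 0 (A ^ 2)) (fun w => ∏ j ∈ Finset.range n, ((A + j) ^ 2 - w)⁻¹) ∧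
    MonotoneOn (fun w => ∏ j ∈ Finset.range n, ((A + j) ^ 2 - w)⁻¹) (Set.Ico 0 (A ^ 2)) ∧
    ∀ w ∈ Set.Ico 0 (A ^ 2), 0 ≤ ∏ j ∈ Finset.range n, ((A + j) ^ 2 - w)⁻¹ := by
  have hpos : ∀ j : ℕ, ∀ w ∈ Set.Ico 0 (A ^ 2), 0 < (A + j) ^ 2 - w := by
    intro j w hw
    have : A ^ 2 ≤ (A + j) ^ 2 := pow_le_pow_left₀ hA.le (by simp) 2
    linarith [hw.2]
  induction n with
  | zero =>
    simp only [Finset.range_zero, Finset.prod_empty]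
    exact ⟨convexOn_const _ (convex_Ico _ _), monotoneOn_const, fun _ _ => zero_le_one⟩
  | succ n ih =>
    obtain ⟨h1, h2, h3⟩ := ih
    have g3 : ∀ w ∈ Set.Ico 0 (A ^ 2), 0 ≤ ((A + n) ^ 2 - w)⁻¹ :=
      fun w hw => inv_nonneg.2 (hpos n w hw).le
    have g2 : MonotoneOn (fun w => ((A + n) ^ 2 - w)⁻¹) (Set.Ico 0 (A ^ 2)) := by
      intro x _ y hy hxy
      exact inv_anti₀ (hpos n y hy) (by linarith)
    have g1 : ConvexOn ℝ (Set.Ico 0 (A ^ 2)) (fun w => ((A + n) ^ 2 - w)⁻¹) := by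
      refine ⟨convex_Ico _ _, fun x hx y hy a b ha hb hab => ?_⟩
      have hinv : ConvexOn ℝ (Set.Ioi 0) fun x : ℝ => x⁻¹ := by
        simpa using convexOn_zpow (𝕜 := ℝ) (-1)
      have := hinv.2 (hpos n x hx) (hpos n y hy) ha hb hab
      simp only [smul_eq_mul] at this ⊢
      refine le_trans (le_of_eq ?_) this
      congr 1
      linear_combination (-(A + n) ^ 2) * hab
    simp only [Finset.prod_range_succ]
    refine ⟨h1.mul g1 (fun x hx => h3 x hx) (fun x hx => g3 x hx) (h2.monovaryOn g2), ?_, ?_⟩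
    · intro x hx y hy hxy
      exact mul_le_mul (h2 hx hy hxy) (g2 hx hy hxy) (g3 x hx) (h3 y hy)
    · intro w hw
      exact mul_nonneg (h3 w hw) (g3 w hw)

/-- Euler's limit for both Gamma factors; the factors `A + j ± √w` pair up to `(A + j)² - w`, which
is free of the square root. -/
theorem tendsto_gammaPair_sqrt {A : ℝ} {w : ℝ} (hw : 0 ≤ w) :
    Filter.Tendsto (fun n : ℕ => ((n : ℝ) ^ (A + √w) * n.factorial *
        ((n : ℝ) ^ (A - √w) * n.factorial)) *
      ∏ j ∈ Finset.range (n + 1), ((A + j) ^ 2 - w)⁻¹) Filter.atTop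
      (nhds (gammaPair A (√w))) := by
  refine ((Real.GammaSeq_tendsto_Gamma (A + √w)).mul
    (Real.GammaSeq_tendsto_Gamma (A - √w))).congr fun n => ?_
  rw [Real.GammaSeq, Real.GammaSeq, div_mul_div_comm, ← Finset.prod_mul_distrib,
    Finset.prod_inv_distrib, div_eq_mul_inv]
  congr 2
  refine Finset.prod_congr rfl fun j _ => ?_
  linear_combination -Real.sq_sqrt hw

theorem tendsto_gammaPair_sqrt' {A : ℝ} {w : ℝ} (hw : 0 ≤ w) :
    Filter.Tendsto (fun n : ℕ => ((n : ℝ) ^ A * (n : ℝ) ^ A * (n.factorial * n.factorial)) *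
      ∏ j ∈ Finset.range (n + 1), ((A + j) ^ 2 - w)⁻¹) Filter.atTop
      (nhds (gammaPair A (√w))) := by
  refine (tendsto_gammaPair_sqrt hw).congr' ?_
  filter_upwards [Filter.eventually_gt_atTop 0] with n hn
  have hn' : (0 : ℝ) < n := by exact_mod_cast hn
  -- The exponents `A ± √w` add up to `2A`, so the prefactor no longer depends on `w`, and convexity
  -- in `w` can be read off from the product alone.
  have h : (n : ℝ) ^ (A + √w) * (n : ℝ) ^ (A - √w) = (n : ℝ) ^ A * (n : ℝ) ^ A := by
    rw [← Real.rpow_add hn', ← Real.rpow_add hn']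
    congr 1
    ring
  congr 1
  linear_combination (n.factorial * n.factorial : ℝ) * h

theorem gammaPair_sqrt_convexOn {A : ℝ} (hA : 0 < A) :
    ConvexOn ℝ (Set.Ico 0 (A ^ 2)) (fun w => gammaPair A (√w)) := by
  refine ⟨convex_Ico _ _, fun x hx y hy a b ha hb hab => ?_⟩
  have hz := convex_Ico (0 : ℝ) (A ^ 2) hx hy ha hb hab
  refine le_of_tendsto_of_tendsto' (tendsto_gammaPair_sqrt' hz.1)
    (((tendsto_gammaPair_sqrt' hx.1).const_smul a).add
      ((tendsto_gammaPair_sqrt' hy.1).const_smul b)) fun n => ?_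
  have h := (prod_inv_sub_convexOn hA (n + 1)).1.2 hx hy ha hb hab
  have hc : 0 ≤ (n : ℝ) ^ A * (n : ℝ) ^ A * (n.factorial * n.factorial) := by positivity
  have := mul_le_mul_of_nonneg_left h hc
  simp only [smul_eq_mul] at this ⊢
  linarith

theorem gammaPair_sqrt_monotoneOn {A : ℝ} (hA : 0 < A) :
    MonotoneOn (fun w => gammaPair A (√w)) (Set.Ico 0 (A ^ 2)) := by
  intro x hx y hy hxy
  refine le_of_tendsto_of_tendsto' (tendsto_gammaPair_sqrt' hx.1)
    (tendsto_gammaPair_sqrt' hy.1) fun n => ?_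
  exact mul_le_mul_of_nonneg_left ((prod_inv_sub_convexOn hA (n + 1)).2.1 hx hy hxy)
    (by positivity)

theorem gammaPair_le_gammaPair {A x y : ℝ} (hxy : |x| ≤ |y|) (hy : |y| < A) :
    gammaPair A x ≤ gammaPair A y := by
  have hA : 0 < A := (abs_nonneg y).trans_lt hy
  have h1 : x ^ 2 ≤ y ^ 2 := sq_le_sq.2 hxy
  have h2 : y ^ 2 < A ^ 2 := sq_lt_sq.2 (by rwa [abs_of_pos hA])
  have := gammaPair_sqrt_monotoneOn hA (a := x ^ 2) (b := y ^ 2)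
    ⟨sq_nonneg _, h1.trans_lt h2⟩ ⟨sq_nonneg _, h2⟩ h1
  simpa only [gammaPair_sqrt_sq] using this

theorem gammaPair_add_one {A y : ℝ} (h1 : -A < y) (h2 : y + 1 < A) :
    (A - y - 1) * gammaPair A (y + 1) = (A + y) * gammaPair A y := by
  have e1 : Real.Gamma (A + (y + 1)) = (A + y) * Real.Gamma (A + y) := by
    rw [← Real.Gamma_add_one (by linarith)]
    congr 1
    ring
  have e2 : Real.Gamma (A - y) = (A - y - 1) * Real.Gamma (A - (y + 1)) := by
    rw [show A - (y + 1) = A - y - 1 by ring, ← Real.Gamma_add_one (by linarith)]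
    congr 1
    ring
  rw [gammaPair, gammaPair, e1, e2]
  ring

/-- Quadratic-exponential growth of `y ↦ Γ(A + y) Γ(A - y)`. -/
theorem exp_mul_gammaPair_le {B : ℝ} (hB : 0 < B) (n : ℕ) :
    ∀ y : ℝ, -(1 / 2) ≤ y → y ≤ 1 / 2 + n → y ≤ B →
      Real.exp ((y ^ 2 - 1 / 4) / B) * gammaPair (B + 1 / 2) 0 ≤ gammaPair (B + 1 / 2) y := by
  have base : ∀ y : ℝ, -(1 / 2) ≤ y → y ≤ 1 / 2 → y ≤ B →
      Real.exp ((y ^ 2 - 1 / 4) / B) * gammaPair (B + 1 / 2) 0 ≤ gammaPair (B + 1 / 2) y := by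
    intro y h1 h2 h3
    have hy : |y| < B + 1 / 2 := abs_lt.2 ⟨by linarith, by linarith⟩
    have hpos : 0 ≤ gammaPair (B + 1 / 2) 0 := (gammaPair_pos (by linarith) (by linarith)).le
    calc _ ≤ 1 * gammaPair (B + 1 / 2) 0 := by
          refine mul_le_mul_of_nonneg_right ?_ hpos
          rw [Real.exp_le_one_iff]
          exact div_nonpos_of_nonpos_of_nonneg (by nlinarith) hB.le
      _ ≤ _ := by
          rw [one_mul]
          exact gammaPair_le_gammaPair (by simp) hy
  induction n with
  | zero =>
    intro y h1 h2 h3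
    exact base y h1 (by simpa using h2) h3
  | succ n ih =>
    intro y h1 h2 h3
    rcases le_total y (1 / 2) with hy | hy
    · exact base y h1 hy h3
    push_cast at h2
    have h := ih (y - 1) (by linarith) (by linarith) (by linarith)
    have hs := gammaPair_add_one (A := B + 1 / 2) (y := y - 1) (by linarith) (by linarith)
    rw [sub_add_cancel] at hs
    have hd : 0 < B + 1 / 2 - y := by linarith
    have hpos : 0 < gammaPair (B + 1 / 2) y := gammaPair_pos (by linarith) (by linarith)
    -- With this `z`, passing from `y - 1` to `y` multiplies the Gamma pair by `(1 + z)/(1 - z)` and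
    -- the exponential by `e^{2z}`.
    set z := (y - 1 / 2) / B with hz
    have hz0 : 0 ≤ z := div_nonneg (by linarith) hB.le
    have hzB : z * B = y - 1 / 2 := by rw [hz]; field_simp
    have hz1 : z < 1 := by rw [hz, div_lt_one hB]; linarith
    -- This keeps only the first term `2z` of the series of `log ((1 + z)/(1 - z))`.
    have hexp : Real.exp (2 * z) * (1 - z) ≤ 1 + z := by
      have hl := Real.hasSum_log_sub_log_of_abs_lt_one (x := z) (by rw [abs_of_nonneg hz0]; exact hz1)
      have hle := hl.summable.le_tsum 0 (fun k _ => by positivity)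
      rw [hl.tsum_eq] at hle
      norm_num at hle
      have h2z : 2 * z ≤ Real.log ((1 + z) / (1 - z)) := by
        rw [Real.log_div (by linarith) (by linarith)]
        exact hle
      have := Real.exp_le_exp.2 h2z
      rw [Real.exp_log (div_pos (by linarith) (by linarith))] at this
      rwa [le_div_iff₀ (by linarith)] at this
    have hsplit : Real.exp ((y ^ 2 - 1 / 4) / B)
        = Real.exp (2 * z) * Real.exp (((y - 1) ^ 2 - 1 / 4) / B) := by
      rw [← Real.exp_add]
      congr 1
      rw [hz]
      field_simp
      ring
    have e1 : B + 1 / 2 + (y - 1) = B * (1 + z) := by linarith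
    have e2 : B + 1 / 2 - (y - 1) - 1 = B * (1 - z) := by linarith
    rw [e1, e2] at hs
    have hs' : (1 - z) * gammaPair (B + 1 / 2) y = (1 + z) * gammaPair (B + 1 / 2) (y - 1) := by
      apply mul_left_cancel₀ hB.ne'
      linarith
    have hpos' : 0 ≤ gammaPair (B + 1 / 2) (y - 1) :=
      (gammaPair_pos (by linarith) (by linarith)).le
    have h1z : 0 < 1 - z := by linarith
    apply le_of_mul_le_mul_left _ h1z
    rw [hs', hsplit]
    calc _ = Real.exp (2 * z) * (1 - z)
            * (Real.exp (((y - 1) ^ 2 - 1 / 4) / B) * gammaPair (B + 1 / 2) 0) := by ring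
      _ ≤ Real.exp (2 * z) * (1 - z) * gammaPair (B + 1 / 2) (y - 1) :=
          mul_le_mul_of_nonneg_left h (by positivity)
      _ ≤ _ := mul_le_mul_of_nonneg_right hexp hpos'

theorem Gamma_le_one_of_mem_Icc {x : ℝ} (h1 : 1 ≤ x) (h2 : x ≤ 2) : Real.Gamma x ≤ 1 := by
  have := Real.convexOn_Gamma.2 (show (1 : ℝ) ∈ Set.Ioi 0 by simp)
    (show (2 : ℝ) ∈ Set.Ioi 0 by simp) (by linarith : (0 : ℝ) ≤ 2 - x)
    (by linarith : (0 : ℝ) ≤ x - 1) (by ring)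
  rw [Real.Gamma_one, Real.Gamma_two] at this
  simp only [smul_eq_mul] at this
  calc Real.Gamma x = Real.Gamma ((2 - x) * 1 + (x - 1) * 2) := by congr 1; ring
    _ ≤ _ := this
    _ = 1 := by ring

/-- The two arguments are `1/4` and `t + 3/4`: `Γ(1/4) = 4 Γ(5/4) ≤ 4`, and monotonicity on `[2, ∞)`
compares the other with `Γ(t + 1)`. For `t = 1` the argument `7/4` lies outside that range and is
treated apart. -/
theorem gammaPair_le_factorial {t : ℕ} (ht : 1 ≤ t) :
    gammaPair (((t : ℝ) + 1) / 2) ((t + 1 / 2) / 2) ≤ 4 * t.factorial := by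
  have e1 : Real.Gamma (((t : ℝ) + 1) / 2 - (t + 1 / 2) / 2) ≤ 4 := by
    rw [show ((t : ℝ) + 1) / 2 - (t + 1 / 2) / 2 = 1 / 4 by ring]
    have h := Real.Gamma_add_one (s := 1 / 4) (by norm_num)
    have h' : Real.Gamma (1 / 4 + 1) ≤ 1 := Gamma_le_one_of_mem_Icc (by norm_num) (by norm_num)
    linarith
  have e2 : Real.Gamma (((t : ℝ) + 1) / 2 + (t + 1 / 2) / 2) ≤ t.factorial := by
    rw [← Real.Gamma_nat_eq_factorial]
    rcases ht.eq_or_lt with rfl | ht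
    · rw [Real.Gamma_nat_eq_factorial]
      norm_num
      exact Gamma_le_one_of_mem_Icc (by norm_num) (by norm_num)
    · have ht' : (2 : ℝ) ≤ t := by exact_mod_cast ht
      apply Real.Gamma_strictMonoOn_Ici.monotoneOn
      · simp only [Set.mem_Ici]; linarith
      · simp only [Set.mem_Ici]; linarith
      · linarith
  rw [gammaPair, mul_comm]
  exact mul_le_mul e1 e2 (Real.Gamma_pos_of_pos (by positivity)).le (by norm_num)

/-- Legendre duplication evaluates `Γ(s) Γ(s + 1/2)`, and monotonicity of the Gamma pair gives `Γ(s
+ 1/2)² ≤ Γ(s) Γ(s + 1) = s Γ(s)²`. -/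
theorem gammaPair_zero_ge (t : ℕ) :
    √(2 / ((t : ℝ) + 1)) * (t.factorial * √Real.pi)
      ≤ 2 ^ t * gammaPair (((t : ℝ) + 1) / 2) 0 := by
  set s : ℝ := ((t : ℝ) + 1) / 2 with hs
  have hs0 : 0 < s := by positivity
  have hdup := Real.Gamma_mul_Gamma_add_half s
  have e1 : Real.Gamma (2 * s) = t.factorial := by
    rw [hs, ← Real.Gamma_nat_eq_factorial]; congr 1; ring
  have e2 : (2 : ℝ) ^ (1 - 2 * s) = (2 ^ t)⁻¹ := by
    rw [show 1 - 2 * s = -(t : ℝ) by rw [hs]; ring, Real.rpow_neg (by norm_num),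
      Real.rpow_natCast]
  rw [e1, e2] at hdup
  have hmono : gammaPair (s + 1 / 2) 0 ≤ gammaPair (s + 1 / 2) (1 / 2) :=
    gammaPair_le_gammaPair (by simp) (by rw [abs_of_pos (by norm_num)]; linarith)
  simp only [gammaPair, add_zero, sub_zero, add_sub_cancel_right] at hmono ⊢
  rw [show s + 1 / 2 + 1 / 2 = s + 1 by ring, Real.Gamma_add_one hs0.ne'] at hmono
  have hG : 0 < Real.Gamma s := Real.Gamma_pos_of_pos hs0
  have hG' : 0 < Real.Gamma (s + 1 / 2) := Real.Gamma_pos_of_pos (by positivity)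
  have h3 : √(1 / s) * Real.Gamma (s + 1 / 2) ≤ Real.Gamma s := by
    apply le_of_sq_le_sq _ hG.le
    rw [mul_pow, Real.sq_sqrt (by positivity), one_div, inv_mul_le_iff₀ hs0]
    linarith
  have e3 : 2 / ((t : ℝ) + 1) = 1 / s := by rw [hs]; field_simp
  rw [e3]
  have h2t : (0 : ℝ) < 2 ^ t := by positivity
  calc √(1 / s) * (t.factorial * √Real.pi)
      = 2 ^ t * (Real.Gamma s * (√(1 / s) * Real.Gamma (s + 1 / 2))) := by
        rw [show Real.Gamma s * (√(1 / s) * Real.Gamma (s + 1 / 2))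
          = √(1 / s) * (Real.Gamma s * Real.Gamma (s + 1 / 2)) by ring, hdup]
        field_simp
    _ ≤ _ := by gcongr

/-! ### Properties of the potentials -/

theorem Potential.fn_KT (ε : ℝ) (t : ℕ) (x : ℝ) : Potential.KT.fn ε t x
    = ε * 2 ^ t / (Real.pi * t.factorial) * gammaPair (((t : ℝ) + 1) / 2) (x / 2) := by
  rw [Potential.fn, gammaPair]
  ring

theorem Potential.fn_SE (ε : ℝ) (t : ℕ) (x : ℝ) : Potential.SE.fn ε t x
    = ε / √((t : ℝ) + 1) * Real.exp (x ^ 2 / (2 * ((t : ℝ) + 1))) := rfl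

theorem Potential.fn_neg (P : Potential) (ε : ℝ) (t : ℕ) (x : ℝ) : P.fn ε t (-x) = P.fn ε t x := by
  cases P with
  | KT => rw [Potential.fn_KT, Potential.fn_KT, neg_div, gammaPair_neg]
  | SE => rw [Potential.fn_SE, Potential.fn_SE, neg_sq]

theorem Potential.fn_sqrt_sq (P : Potential) (ε : ℝ) (t : ℕ) (x : ℝ) :
    P.fn ε t √(x ^ 2) = P.fn ε t x := by
  rw [Real.sqrt_sq_eq_abs]
  rcases abs_choice x with h | h <;> rw [h]
  exact P.fn_neg ε t x

theorem Potential.fn_zero (P : Potential) (ε : ℝ) : P.fn ε 0 0 = ε := by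
  cases P with
  | KT =>
    simp only [Potential.fn]
    norm_num [Real.Gamma_one_half_eq]
    field_simp
    rw [Real.sq_sqrt Real.pi_pos.le]
  | SE => simp [Potential.fn]

theorem sqrt_div_four (z : ℝ) : √z / 2 = √(z / 4) := by
  rw [Real.sqrt_div' _ (by norm_num), show (4 : ℝ) = 2 ^ 2 by norm_num,
    Real.sqrt_sq (by norm_num)]

variable {ε : ℝ}

theorem Potential.fn_pos (P : Potential) (hε : 0 < ε) {t : ℕ} {x : ℝ} (hx : |x| < t + 1) :
    0 < P.fn ε t x := by
  cases P with
  | KT =>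
    rw [Potential.fn_KT]
    have := abs_lt.1 hx
    have := gammaPair_pos (A := ((t : ℝ) + 1) / 2) (y := x / 2) (by linarith) (by linarith)
    positivity
  | SE =>
    rw [Potential.fn_SE]
    positivity

theorem Potential.fn_le_fn (P : Potential) (hε : 0 < ε) {t : ℕ} {x y : ℝ} (hxy : |x| ≤ |y|)
    (hy : |y| < t + 1) : P.fn ε t x ≤ P.fn ε t y := by
  cases P with
  | KT =>
    rw [Potential.fn_KT, Potential.fn_KT]
    refine mul_le_mul_of_nonneg_left (gammaPair_le_gammaPair ?_ ?_) (by positivity)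
    · rw [abs_div, abs_div]
      gcongr
    · rw [abs_div, abs_two]
      linarith
  | SE =>
    rw [Potential.fn_SE, Potential.fn_SE]
    have := sq_le_sq.2 hxy
    gcongr

/-- Convexity in the squared norm, rather than in the norm, is what reduces a vector coin to a
random sign in `fn_succ_norm_add_le`. -/
theorem Potential.fn_sqrt_convexOn (P : Potential) (hε : 0 < ε) (t : ℕ) :
    ConvexOn ℝ (Set.Ico 0 (((t : ℝ) + 1) ^ 2)) (fun z => P.fn ε t √z) := by
  refine ⟨convex_Ico _ _, fun x hx y hy a b ha hb hab => ?_⟩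
  cases P with
  | KT =>
    have hmem : ∀ z ∈ Set.Ico 0 (((t : ℝ) + 1) ^ 2),
        z / 4 ∈ Set.Ico 0 ((((t : ℝ) + 1) / 2) ^ 2) := by
      intro z hz
      constructor <;> linarith [hz.1, hz.2]
    have h := (gammaPair_sqrt_convexOn (A := ((t : ℝ) + 1) / 2) (by positivity)).2
      (hmem x hx) (hmem y hy) ha hb hab
    have hc : 0 ≤ ε * 2 ^ t / (Real.pi * t.factorial) := by positivity
    have := mul_le_mul_of_nonneg_left h hc
    simp only [Potential.fn_KT, sqrt_div_four, smul_eq_mul] at this ⊢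
    rw [show (a * x + b * y) / 4 = a * (x / 4) + b * (y / 4) by ring]
    linarith
  | SE =>
    have hz := convex_Ico (0 : ℝ) _ hx hy ha hb hab
    have h := convexOn_exp.2 (Set.mem_univ (x / (2 * ((t : ℝ) + 1))))
      (Set.mem_univ (y / (2 * ((t : ℝ) + 1)))) ha hb hab
    have hc : 0 ≤ ε / √((t : ℝ) + 1) := by positivity
    have := mul_le_mul_of_nonneg_left h hc
    simp only [Potential.fn_SE, Real.sq_sqrt hx.1, Real.sq_sqrt hy.1, Real.sq_sqrt hz.1]
    simp only [smul_eq_mul] at this ⊢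
    rw [show (a * x + b * y) / (2 * ((t : ℝ) + 1))
      = a * (x / (2 * ((t : ℝ) + 1))) + b * (y / (2 * ((t : ℝ) + 1))) by ring]
    linarith

theorem Potential.fn_KT_succ_add_one {t : ℕ} {x : ℝ} (hx : |x| < t + 1) :
    Potential.KT.fn ε (t + 1) (x + 1) = (1 + x / (t + 1)) * Potential.KT.fn ε t x := by
  have h1 := (abs_lt.1 hx).1
  have e1 : Real.Gamma ((((t + 1 : ℕ) : ℝ) + 1) / 2 + (x + 1) / 2)
      = (((t : ℝ) + 1) / 2 + x / 2) * Real.Gamma (((t : ℝ) + 1) / 2 + x / 2) := by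
    rw [← Real.Gamma_add_one (by linarith)]
    push_cast
    congr 1
    ring
  have e2 : (((t + 1 : ℕ) : ℝ) + 1) / 2 - (x + 1) / 2 = ((t : ℝ) + 1) / 2 - x / 2 := by
    push_cast
    ring
  rw [Potential.fn_KT, Potential.fn_KT, gammaPair, gammaPair, e1, e2, Nat.factorial_succ]
  push_cast
  field_simp
  ring

theorem Potential.fn_KT_succ_sub_one {t : ℕ} {x : ℝ} (hx : |x| < t + 1) :
    Potential.KT.fn ε (t + 1) (x - 1) = (1 - x / (t + 1)) * Potential.KT.fn ε t x := by
  have h := Potential.fn_KT_succ_add_one (ε := ε) (t := t) (x := -x) (by rwa [abs_neg])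
  rw [Potential.fn_neg, show -x + 1 = -(x - 1) by ring, Potential.fn_neg] at h
  rw [h]
  ring

theorem Potential.fn_SE_succ_add_one (t : ℕ) (x : ℝ) : Potential.SE.fn ε (t + 1) (x + 1)
    = ε / √((t : ℝ) + 2) * Real.exp ((x ^ 2 + 1) / (2 * ((t : ℝ) + 2)))
      * Real.exp (x / (t + 2)) := by
  rw [Potential.fn_SE, mul_assoc, ← Real.exp_add]
  push_cast
  rw [show (t : ℝ) + 1 + 1 = t + 2 by ring]
  congr 2
  field_simp
  ring

theorem Potential.fn_SE_succ_sub_one (t : ℕ) (x : ℝ) : Potential.SE.fn ε (t + 1) (x - 1)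
    = ε / √((t : ℝ) + 2) * Real.exp ((x ^ 2 + 1) / (2 * ((t : ℝ) + 2)))
      * Real.exp (-(x / (t + 2))) := by
  have h := Potential.fn_SE_succ_add_one (ε := ε) t (-x)
  rw [show -x + 1 = -(x - 1) by ring, Potential.fn_neg, neg_sq, neg_div] at h
  exact h

/-- The potential does not grow on average under a fair coin. For KT this is an equality; for SE it
follows from `cosh y ≤ e^{y²/2}`, from `1/(t+2) + 1/(t+2)² ≤ 1/(t+1)`, and from `e^{1/(t+2)} ≤
(t+2)/(t+1)`. -/
theorem Potential.fn_succ_add_le (P : Potential) (hε : 0 < ε) {t : ℕ} {x : ℝ}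
    (hx : |x| < t + 1) :
    P.fn ε (t + 1) (x + 1) + P.fn ε (t + 1) (x - 1) ≤ 2 * P.fn ε t x := by
  cases P with
  | KT =>
    rw [Potential.fn_KT_succ_add_one hx, Potential.fn_KT_succ_sub_one hx]
    linarith
  | SE =>
    rw [Potential.fn_SE_succ_add_one, Potential.fn_SE_succ_sub_one, Potential.fn_SE]
    have ht : (0 : ℝ) ≤ t := Nat.cast_nonneg t
    have hcosh := Real.cosh_le_exp_half_sq (x / ((t : ℝ) + 2))
    rw [Real.cosh_eq] at hcosh
    have hexp : Real.exp (x / (t + 2)) + Real.exp (-(x / (t + 2)))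
        ≤ 2 * Real.exp ((x / ((t : ℝ) + 2)) ^ 2 / 2) := by linarith
    have hquad : (x ^ 2 + 1) / (2 * ((t : ℝ) + 2)) + (x / ((t : ℝ) + 2)) ^ 2 / 2
        ≤ x ^ 2 / (2 * ((t : ℝ) + 1)) + 1 / (2 * ((t : ℝ) + 2)) := by
      have : x ^ 2 * (1 / ((t : ℝ) + 2) + 1 / ((t : ℝ) + 2) ^ 2) ≤ x ^ 2 * (1 / ((t : ℝ) + 1)) := by
        apply mul_le_mul_of_nonneg_left _ (sq_nonneg x)
        rw [div_add_div _ _ (by positivity) (by positivity),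
          div_le_div_iff₀ (by positivity) (by positivity)]
        nlinarith
      calc _ = 1 / 2 * (x ^ 2 * (1 / ((t : ℝ) + 2) + 1 / ((t : ℝ) + 2) ^ 2))
            + 1 / (2 * ((t : ℝ) + 2)) := by field_simp; ring
        _ ≤ 1 / 2 * (x ^ 2 * (1 / ((t : ℝ) + 1))) + 1 / (2 * ((t : ℝ) + 2)) := by linarith
        _ = _ := by field_simp
    have hsqrt : Real.exp (1 / (2 * ((t : ℝ) + 2))) * √((t : ℝ) + 1) ≤ √((t : ℝ) + 2) := by
      apply Real.le_sqrt_of_sq_le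
      rw [mul_pow, Real.sq_sqrt (by positivity), ← Real.exp_nat_mul]
      have h := Real.add_one_le_exp (-(1 / ((t : ℝ) + 2)))
      rw [Real.exp_neg, show -(1 / ((t : ℝ) + 2)) + 1 = ((t : ℝ) + 1) / (t + 2) by
        field_simp; ring, div_le_iff₀ (by positivity)] at h
      have e : ((2 : ℕ) : ℝ) * (1 / (2 * ((t : ℝ) + 2))) = 1 / ((t : ℝ) + 2) := by
        push_cast
        field_simp
      rw [e]
      have := mul_le_mul_of_nonneg_left h (Real.exp_pos (1 / ((t : ℝ) + 2))).le
      rwa [← mul_assoc, mul_inv_cancel₀ (Real.exp_pos _).ne', one_mul] at this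
    have hs1 : 0 < √((t : ℝ) + 1) := by positivity
    have hs2 : 0 < √((t : ℝ) + 2) := by positivity
    have hc : 0 ≤ ε / √((t : ℝ) + 2) * Real.exp ((x ^ 2 + 1) / (2 * ((t : ℝ) + 2))) := by
      positivity
    calc _ = ε / √((t : ℝ) + 2) * Real.exp ((x ^ 2 + 1) / (2 * ((t : ℝ) + 2)))
          * (Real.exp (x / (t + 2)) + Real.exp (-(x / (t + 2)))) := by ring
      _ ≤ ε / √((t : ℝ) + 2) * Real.exp ((x ^ 2 + 1) / (2 * ((t : ℝ) + 2)))
          * (2 * Real.exp ((x / ((t : ℝ) + 2)) ^ 2 / 2)) := mul_le_mul_of_nonneg_left hexp hc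
      _ = 2 * (ε / √((t : ℝ) + 2)) * Real.exp ((x ^ 2 + 1) / (2 * ((t : ℝ) + 2))
          + (x / ((t : ℝ) + 2)) ^ 2 / 2) := by rw [Real.exp_add]; ring
      _ ≤ 2 * (ε / √((t : ℝ) + 2)) * Real.exp (x ^ 2 / (2 * ((t : ℝ) + 1))
          + 1 / (2 * ((t : ℝ) + 2))) := by gcongr
      _ = 2 * ε * Real.exp (x ^ 2 / (2 * ((t : ℝ) + 1)))
          * (Real.exp (1 / (2 * ((t : ℝ) + 2))) / √((t : ℝ) + 2)) := by
        rw [Real.exp_add]; ring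
      _ ≤ 2 * ε * Real.exp (x ^ 2 / (2 * ((t : ℝ) + 1))) * (1 / √((t : ℝ) + 1)) := by
        refine mul_le_mul_of_nonneg_left ?_ (by positivity)
        rw [div_le_div_iff₀ hs2 hs1, one_mul]
        exact hsqrt
      _ = _ := by ring

/-! ### Conjugates of the potentials -/

/-- A bound on the conjugate of a Gaussian-type function. Below a threshold `x₀` the bound `f ≥ β`
suffices; above it the tangent line of `β e^{x²/(2α)}` at `x₀` has slope at least `r`, so `x * r -
f` cannot exceed its bound at `x₀`. -/
theorem mul_sub_le_of_mul_exp_le {α β r x f : ℝ} (hα : 0 < α) (hβ : 0 < β) (hr : 0 ≤ r)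
    (hf : β * Real.exp (x ^ 2 / (2 * α)) ≤ f) :
    x * r - f ≤ r * √(α * Real.log (1 + α * r ^ 2 / β ^ 2)) - β := by
  set s : ℝ := α * r ^ 2 / β ^ 2 with hs
  have hs0 : 0 ≤ s := by positivity
  have hL0 : 0 ≤ Real.log (1 + s) := Real.log_nonneg (by linarith)
  -- The threshold makes `exp (x₀² / (2α))` equal to `√(1 + s)`; the slope condition then reduces to
  -- `s ≤ (1 + s) log (1 + s)`.
  set x₀ : ℝ := √(α * Real.log (1 + s)) with hx₀
  have hx₀0 : 0 ≤ x₀ := Real.sqrt_nonneg _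
  have hx₀sq : x₀ ^ 2 = α * Real.log (1 + s) := Real.sq_sqrt (by positivity)
  rcases le_total x x₀ with h | h
  · have h1 : 1 ≤ Real.exp (x ^ 2 / (2 * α)) := Real.one_le_exp (by positivity)
    nlinarith [mul_le_mul_of_nonneg_right h hr]
  · set E : ℝ := Real.exp (x₀ ^ 2 / (2 * α)) with hE
    have hE1 : 1 ≤ E := Real.one_le_exp (by positivity)
    have hEsq : E ^ 2 = 1 + s := by
      rw [hE, ← Real.exp_nat_mul, hx₀sq, show ((2 : ℕ) : ℝ) * (α * Real.log (1 + s) / (2 * α))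
        = Real.log (1 + s) by push_cast; field_simp, Real.exp_log (by linarith)]
    have hlog : s ≤ (1 + s) * Real.log (1 + s) := by
      have h1 := Real.one_sub_inv_le_log_of_pos (show 0 < 1 + s by linarith)
      have h2 := mul_le_mul_of_nonneg_left h1 (show 0 ≤ 1 + s by linarith)
      rw [mul_sub, mul_inv_cancel₀ (by linarith)] at h2
      linarith
    have hslope : α * r ≤ β * E * x₀ := by
      apply le_of_sq_le_sq _ (by positivity)
      have e1 : α ^ 2 * r ^ 2 = β ^ 2 * α * s := by rw [hs]; field_simp
      calc (α * r) ^ 2 = β ^ 2 * α * s := by rw [mul_pow, e1]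
        _ ≤ β ^ 2 * α * ((1 + s) * Real.log (1 + s)) := by gcongr
        _ = (β * E * x₀) ^ 2 := by rw [mul_pow, mul_pow, hEsq, hx₀sq]; ring
    have hexp : E * (1 + x₀ * (x - x₀) / α) ≤ Real.exp (x ^ 2 / (2 * α)) := by
      have h1 := Real.add_one_le_exp ((x ^ 2 - x₀ ^ 2) / (2 * α))
      have h2 : Real.exp (x ^ 2 / (2 * α)) = E * Real.exp ((x ^ 2 - x₀ ^ 2) / (2 * α)) := by
        rw [hE, ← Real.exp_add]; congr 1; ring
      rw [h2]
      refine mul_le_mul_of_nonneg_left (le_trans ?_ h1) (by linarith)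
      have h3 : x₀ * (x - x₀) / α ≤ (x ^ 2 - x₀ ^ 2) / (2 * α) := by
        rw [div_le_div_iff₀ hα (by positivity)]
        nlinarith [mul_nonneg hα.le (sq_nonneg (x - x₀))]
      linarith
    have h4 : r * (x - x₀) ≤ β * (E * (x₀ * (x - x₀) / α)) := by
      rw [show β * (E * (x₀ * (x - x₀) / α)) = (β * E * x₀) * (x - x₀) / α by ring,
        le_div_iff₀ hα]
      nlinarith [mul_le_mul_of_nonneg_right hslope (sub_nonneg.2 h)]
    nlinarith [mul_le_mul_of_nonneg_left hexp hβ.le]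

theorem Potential.mul_exp_le_fn_KT (hε : 0 < ε) {T : ℕ} (hT : 1 ≤ T) {x : ℝ} (hx0 : 0 ≤ x)
    (hxT : x ≤ T) :
    ε / (Real.exp 1 * √(Real.pi * T)) * Real.exp (x ^ 2 / (2 * (2 * ((T : ℝ) + 1))))
      ≤ Potential.KT.fn ε T x := by
  have hT' : (1 : ℝ) ≤ T := by exact_mod_cast hT
  have h1 := exp_mul_gammaPair_le (B := (T : ℝ) / 2) (by positivity) T (x / 2) (by linarith)
    (by linarith) (by linarith)
  have h2 := gammaPair_zero_ge T
  rw [show (T : ℝ) / 2 + 1 / 2 = ((T : ℝ) + 1) / 2 by ring,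
    show ((x / 2) ^ 2 - 1 / 4) / ((T : ℝ) / 2) = (x ^ 2 - 1) / (2 * T) by field_simp; ring] at h1
  -- The factor `e` pays for `e^{-1/(2T)}`, and the exponent is weakened to `x² / (4(T+1))` to match
  -- the closed form.
  have h3 : Real.exp (x ^ 2 / (2 * (2 * ((T : ℝ) + 1)))) / Real.exp 1
      ≤ Real.exp ((x ^ 2 - 1) / (2 * T)) := by
    rw [← Real.exp_sub]
    apply Real.exp_le_exp.2
    have a1 : x ^ 2 / (2 * (2 * ((T : ℝ) + 1))) ≤ x ^ 2 / (2 * T) := by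
      gcongr
      linarith
    have a2 : 1 / (2 * (T : ℝ)) ≤ 1 := by
      rw [div_le_one (by positivity)]
      linarith
    rw [sub_div]
    linarith
  have h4 : 1 / √(T : ℝ) ≤ √(2 / ((T : ℝ) + 1)) := by
    rw [one_div, ← Real.sqrt_inv]
    apply Real.sqrt_le_sqrt
    rw [inv_eq_one_div, div_le_div_iff₀ (by positivity) (by positivity)]
    linarith
  rw [Potential.fn_KT]
  have hpi : 0 < √Real.pi := Real.sqrt_pos.2 Real.pi_pos
  have hTs : 0 < √(T : ℝ) := by positivity
  calc _ = ε / (Real.pi * T.factorial) * (Real.exp (x ^ 2 / (2 * (2 * ((T : ℝ) + 1))))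
        / Real.exp 1 * (1 / √(T : ℝ) * (T.factorial * √Real.pi))) := by
        rw [Real.sqrt_mul Real.pi_pos.le]
        field_simp
        rw [Real.sq_sqrt Real.pi_pos.le]
    _ ≤ ε / (Real.pi * T.factorial) * (Real.exp ((x ^ 2 - 1) / (2 * T))
        * (2 ^ T * gammaPair (((T : ℝ) + 1) / 2) 0)) := by
        refine mul_le_mul_of_nonneg_left ?_ (by positivity)
        refine mul_le_mul h3 (le_trans ?_ h2) (by positivity) (by positivity)
        gcongr
    _ = ε * 2 ^ T / (Real.pi * T.factorial) * (Real.exp ((x ^ 2 - 1) / (2 * T))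
        * gammaPair (((T : ℝ) + 1) / 2) 0) := by ring
    _ ≤ _ := by gcongr

/-- Regret of an ideal bettor: endowment plus the conjugate of the potential. -/
theorem Potential.add_mul_sub_fn_le (P : Potential) (hε : 0 < ε) {T : ℕ} (hT : 1 ≤ T) {x r : ℝ}
    (hx0 : 0 ≤ x) (hxT : x ≤ T) (hr : 0 ≤ r) (N : ℕ) (μ : ℝ) :
    ε + (x * r - P.fn ε T x) + P.regConst ε N μ * √T ≤ P.closedForm ε N μ T r := by
  have hT' : (0 : ℝ) < T := by exact_mod_cast hT
  cases P with
  | KT =>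
    have h := mul_sub_le_of_mul_exp_le (α := 2 * ((T : ℝ) + 1)) (r := r) (by positivity)
      (by positivity) hr (Potential.mul_exp_le_fn_KT hε hT hx0 hxT)
    rw [Real.sqrt_mul (by positivity)] at h
    have e : 2 * ((T : ℝ) + 1) * r ^ 2 / (ε / (Real.exp 1 * √(Real.pi * T))) ^ 2
        = 2 * Real.exp 1 ^ 2 * Real.pi * (T : ℝ) * ((T : ℝ) + 1) * r ^ 2 / ε ^ 2 := by
      rw [div_pow, mul_pow, Real.sq_sqrt (by positivity)]
      field_simp
    rw [e] at h
    simp only [Potential.closedForm]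
    rw [← mul_assoc] at h
    have e2 : ε * (1 - 1 / (Real.exp 1 * √(Real.pi * T)))
        = ε - ε / (Real.exp 1 * √(Real.pi * T)) := by ring
    rw [e2]
    linarith
  | SE =>
    have h := mul_sub_le_of_mul_exp_le (α := (T : ℝ) + 1) (r := r) (by positivity)
      (show 0 < ε / √((T : ℝ) + 1) by positivity) hr (Potential.fn_SE ε T x).ge
    have e : ((T : ℝ) + 1) * r ^ 2 / (ε / √((T : ℝ) + 1)) ^ 2
        = ((T : ℝ) + 1) ^ 2 * r ^ 2 / ε ^ 2 := by
      rw [div_pow, Real.sq_sqrt (by positivity)]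
      field_simp
    rw [e] at h
    simp only [Potential.closedForm]
    have e2 : ε * (1 - 1 / √((T : ℝ) + 1)) = ε - ε / √((T : ℝ) + 1) := by ring
    rw [e2]
    linarith

/-! ### Lipschitz constants of the coin-betting functions -/

/-- A Lipschitz constant of `h_{t+1}` on `[0, t]`. -/
def Potential.lip (ε : ℝ) : Potential → ℕ → ℝ
  | .KT, t => 8 / 3 * ε * 2 ^ t
  | .SE, t => 2 * ε * Real.exp (t / 2)

theorem Potential.lip_nonneg (P : Potential) (hε : 0 < ε) (t : ℕ) : 0 ≤ P.lip ε t := by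
  cases P <;> simp only [Potential.lip] <;> positivity

theorem Potential.coinBet_succ (P : Potential) (t : ℕ) (x : ℝ) : coinBet (P.fn ε) (t + 1) x
    = bettingFraction (P.fn ε) (t + 1) x * P.fn ε t x := by
  rw [coinBet, Nat.add_sub_cancel]

theorem Potential.coinBet_zero (P : Potential) (t : ℕ) : coinBet (P.fn ε) (t + 1) 0 = 0 := by
  rw [P.coinBet_succ, bettingFraction, zero_add, zero_sub, P.fn_neg]
  simp

theorem Potential.bettingFraction_KT (hε : 0 < ε) {t : ℕ} {x : ℝ} (hx : |x| < t + 1) :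
    bettingFraction (Potential.KT.fn ε) (t + 1) x = x / (t + 1) := by
  have h := Potential.KT.fn_pos hε hx
  rw [bettingFraction, Potential.fn_KT_succ_add_one hx, Potential.fn_KT_succ_sub_one hx]
  field_simp
  ring

theorem Potential.bettingFraction_SE (hε : 0 < ε) (t : ℕ) (x : ℝ) :
    bettingFraction (Potential.SE.fn ε) (t + 1) x = Real.tanh (x / (t + 2)) := by
  rw [bettingFraction, Potential.fn_SE_succ_add_one, Potential.fn_SE_succ_sub_one, ← mul_sub,
    ← mul_add, Real.tanh_eq, mul_div_mul_left]
  positivity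

theorem tanh_sub_tanh_mem_Icc {x y : ℝ} (hy : 0 ≤ y) (hxy : y ≤ x) :
    Real.tanh x - Real.tanh y ∈ Set.Icc 0 (2 * (x - y)) := by
  have key : ∀ z : ℝ, Real.tanh z = 1 - 2 / (Real.exp (2 * z) + 1) := by
    intro z
    rw [Real.tanh_eq, Real.exp_neg, show 2 * z = z + z by ring, Real.exp_add]
    field_simp
    ring
  rw [key, key]
  set a := Real.exp (2 * x) with ha
  set b := Real.exp (2 * y) with hb
  have hb1 : 1 ≤ b := Real.one_le_exp (by linarith)
  have hab : b ≤ a := Real.exp_le_exp.2 (by linarith)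
  have h1 : a - b ≤ a * (2 * (x - y)) := by
    have h := Real.add_one_le_exp (2 * y - 2 * x)
    rw [Real.exp_sub, ← ha, ← hb, le_div_iff₀ (by linarith)] at h
    linarith
  have e : 1 - 2 / (a + 1) - (1 - 2 / (b + 1)) = 2 * (a - b) / ((a + 1) * (b + 1)) := by
    have : a + 1 ≠ 0 := by linarith
    have : b + 1 ≠ 0 := by linarith
    field_simp
    ring
  rw [e]
  have hpos : 0 < (a + 1) * (b + 1) := by nlinarith
  refine ⟨div_nonneg (by linarith) hpos.le, ?_⟩
  rw [div_le_iff₀ hpos]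
  have h2 : 0 ≤ x - y := by linarith
  nlinarith [mul_nonneg h2 (show 0 ≤ (a + 1) * (b + 1) - 2 * a by nlinarith)]

theorem Potential.fn_KT_le (hε : 0 < ε) {t : ℕ} (ht : 1 ≤ t) :
    Potential.KT.fn ε t (t + 1 / 2) ≤ 4 / 3 * ε * 2 ^ t := by
  rw [Potential.fn_KT]
  calc _ ≤ ε * 2 ^ t / (Real.pi * t.factorial) * (4 * t.factorial) :=
        mul_le_mul_of_nonneg_left (gammaPair_le_factorial ht) (by positivity)
    _ = 4 / Real.pi * ε * 2 ^ t := by field_simp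
    _ ≤ _ := by
        gcongr
        exact Real.pi_gt_three.le

/-- Secant slopes of the convex function `z ↦ F_t(√z)` increase, so the slope between `y²` and `x²`
is at most the one ending at `(t + 1/2)²`. That extra half unit stays before the pole at `t + 1` and
avoids differentiating Gamma. -/
theorem Potential.fn_KT_sub_le (hε : 0 < ε) {t : ℕ} {x y : ℝ} (hy : 0 ≤ y) (hxy : y ≤ x)
    (hx : x ≤ t) : Potential.KT.fn ε t x - Potential.KT.fn ε t y
      ≤ 2 * (x - y) * Potential.KT.fn ε t (t + 1 / 2) := by
  have ht : (0 : ℝ) ≤ t := Nat.cast_nonneg t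
  have hM := Potential.KT.fn_pos hε (t := t) (x := t + 1 / 2)
    (by rw [abs_of_pos (by linarith)]; linarith)
  have hY := Potential.KT.fn_pos hε (t := t) (x := y)
    (by rw [abs_of_nonneg hy]; linarith)
  rcases hxy.eq_or_lt with rfl | hlt
  · simp
  have hmem : ∀ z : ℝ, 0 ≤ z → z ≤ t + 1 / 2 → z ^ 2 ∈ Set.Ico 0 (((t : ℝ) + 1) ^ 2) :=
    fun z h0 h1 => ⟨sq_nonneg z, by nlinarith⟩
  have hsq : y ^ 2 < x ^ 2 := by nlinarith
  have hsqM : x ^ 2 + ((t : ℝ) + 1 / 4) ≤ ((t : ℝ) + 1 / 2) ^ 2 := by nlinarith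
  have h := (Potential.KT.fn_sqrt_convexOn hε t).secant_mono (hmem y hy (by linarith))
    (hmem x (by linarith) (by linarith)) (hmem (t + 1 / 2) (by linarith) le_rfl)
    hsq.ne' (by linarith) (by linarith)
  simp only [Potential.fn_sqrt_sq] at h
  rw [div_le_div_iff₀ (by linarith) (by linarith)] at h
  set F := Potential.KT.fn ε t with hF
  have h1 : (F x - F y) * (t + 1 / 4) ≤ F (t + 1 / 2) * (x ^ 2 - y ^ 2) := by
    rcases le_total (F x - F y) 0 with h0 | h0
    · nlinarith [mul_nonneg hM.le (sub_nonneg.2 hsq.le)]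
    · calc _ ≤ (F x - F y) * (((t : ℝ) + 1 / 2) ^ 2 - y ^ 2) :=
            mul_le_mul_of_nonneg_left (by linarith) h0
        _ ≤ _ := h
        _ ≤ _ := mul_le_mul_of_nonneg_right (by linarith) (by linarith)
  have h2 : x ^ 2 - y ^ 2 ≤ 2 * (x - y) * (t + 1 / 4) := by nlinarith
  apply le_of_mul_le_mul_right _ (show (0 : ℝ) < t + 1 / 4 by linarith)
  nlinarith [mul_le_mul_of_nonneg_left h2 hM.le]

theorem Potential.coinBet_lipschitz_of_le (P : Potential) (hε : 0 < ε) {t : ℕ} (ht : 1 ≤ t)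
    {x y : ℝ} (hy : 0 ≤ y) (hxy : y ≤ x) (hx : x ≤ t) :
    |coinBet (P.fn ε) (t + 1) x - coinBet (P.fn ε) (t + 1) y| ≤ P.lip ε t * (x - y) := by
  have ht' : (1 : ℝ) ≤ t := by exact_mod_cast ht
  have hx0 : 0 ≤ x := hy.trans hxy
  have hFx := P.fn_pos hε (t := t) (x := x) (by rw [abs_of_nonneg hx0]; linarith)
  have hFyx : P.fn ε t y ≤ P.fn ε t x := P.fn_le_fn hε
    (by rw [abs_of_nonneg hx0, abs_of_nonneg hy]; exact hxy)
    (by rw [abs_of_nonneg hx0]; linarith)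
  have hd : 0 ≤ x - y := by linarith
  rw [P.coinBet_succ, P.coinBet_succ]
  cases P with
  | KT =>
    rw [Potential.bettingFraction_KT hε (by rw [abs_of_nonneg hx0]; linarith),
      Potential.bettingFraction_KT hε (by rw [abs_of_nonneg hy]; linarith)]
    have h1 := Potential.fn_KT_sub_le hε hy hxy hx
    have h2 := Potential.fn_KT_le hε ht
    have h3 : Potential.KT.fn ε t x ≤ Potential.KT.fn ε t (t + 1 / 2) := Potential.KT.fn_le_fn hε
      (by rw [abs_of_nonneg hx0, abs_of_nonneg (by linarith)]; linarith)
      (by rw [abs_of_nonneg (by linarith)]; linarith)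
    simp only [Potential.lip]
    set F := Potential.KT.fn ε t with hF
    set K : ℝ := 4 / 3 * ε * 2 ^ t with hK
    rw [show x / ((t : ℝ) + 1) * F x - y / ((t : ℝ) + 1) * F y
      = ((x - y) * F x + y * (F x - F y)) / (t + 1) by ring, abs_of_nonneg (by
        apply div_nonneg _ (by linarith)
        nlinarith [mul_nonneg hd hFx.le, mul_nonneg hy (sub_nonneg.2 hFyx)]),
      div_le_iff₀ (by linarith)]
    have h4 : F x - F y ≤ 2 * (x - y) * K :=
      h1.trans (mul_le_mul_of_nonneg_left h2 (by linarith))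
    have hK0 : 0 ≤ K := by positivity
    have h5 : y * (F x - F y) ≤ t * (2 * (x - y) * K) :=
      mul_le_mul (by linarith) h4 (by linarith) (by linarith)
    have h6 : (x - y) * F x ≤ (x - y) * K := mul_le_mul_of_nonneg_left (h3.trans h2) hd
    rw [show 8 / 3 * ε * 2 ^ t = 2 * K by rw [hK]; ring]
    -- The two contributions add up to `(2t + 1)/(t + 1) ≤ 2` times `K * (x - y)`.
    nlinarith [mul_nonneg hd hK0]
  | SE =>
    rw [Potential.bettingFraction_SE hε, Potential.bettingFraction_SE hε]
    have h1 := tanh_sub_tanh_mem_Icc (x := x / ((t : ℝ) + 2)) (y := y / (t + 2)) (by positivity)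
      (by gcongr)
    have hb0 : 0 ≤ Real.tanh (y / ((t : ℝ) + 2)) := by
      have := (tanh_sub_tanh_mem_Icc (x := y / ((t : ℝ) + 2)) le_rfl (by positivity)).1
      simpa using this
    have hb1 := (Real.tanh_lt_one (y / ((t : ℝ) + 2))).le
    simp only [Potential.lip]
    set F := Potential.SE.fn ε t with hF
    set K : ℝ := ε * Real.exp (t / 2) with hK
    have hFK : F x ≤ K := by
      have e1 : x ^ 2 / (2 * ((t : ℝ) + 1)) ≤ t / 2 := by
        rw [div_le_div_iff₀ (by positivity) (by norm_num)]
        nlinarith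
      have e2 : ε / √((t : ℝ) + 1) ≤ ε := by
        apply div_le_self hε.le
        rw [Real.one_le_sqrt]
        linarith
      rw [hF, Potential.fn_SE, hK]
      gcongr
    -- On `[0, t]` the logarithmic derivative `x/(t+1)` of the SE potential is at most one.
    have hdiff : F x - F y ≤ F x * (x - y) := by
      have e1 := Real.add_one_le_exp (y ^ 2 / (2 * ((t : ℝ) + 1)) - x ^ 2 / (2 * ((t : ℝ) + 1)))
      have e2 : F y = F x * Real.exp (y ^ 2 / (2 * ((t : ℝ) + 1)) - x ^ 2 / (2 * ((t : ℝ) + 1))) := by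
        rw [hF, Potential.fn_SE, Potential.fn_SE, mul_assoc, ← Real.exp_add]
        congr 2
        ring
      have e3 : x ^ 2 / (2 * ((t : ℝ) + 1)) - y ^ 2 / (2 * ((t : ℝ) + 1)) ≤ x - y := by
        rw [← sub_div, div_le_iff₀ (by positivity)]
        nlinarith
      rw [e2]
      nlinarith [mul_le_mul_of_nonneg_left e1 hFx.le, mul_le_mul_of_nonneg_left e3 hFx.le]
    have h2 : Real.tanh (x / ((t : ℝ) + 2)) - Real.tanh (y / ((t : ℝ) + 2)) ≤ x - y := by
      refine h1.2.trans ?_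
      rw [← sub_div, ← mul_div_assoc, div_le_iff₀ (by positivity)]
      nlinarith
    rw [show Real.tanh (x / ((t : ℝ) + 2)) * F x - Real.tanh (y / ((t : ℝ) + 2)) * F y
      = (Real.tanh (x / ((t : ℝ) + 2)) - Real.tanh (y / ((t : ℝ) + 2))) * F x
        + Real.tanh (y / ((t : ℝ) + 2)) * (F x - F y) by ring, abs_of_nonneg (by
        have := mul_nonneg h1.1 hFx.le
        have := mul_nonneg hb0 (sub_nonneg.2 hFyx)
        linarith)]
    have h3 := mul_le_mul h2 hFK hFx.le hd
    have h4 : Real.tanh (y / ((t : ℝ) + 2)) * (F x - F y) ≤ 1 * (K * (x - y)) :=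
      mul_le_mul hb1 (hdiff.trans (mul_le_mul_of_nonneg_right hFK hd)) (by linarith) (by norm_num)
    rw [mul_assoc 2 ε, ← hK]
    linarith

theorem Potential.coinBet_lipschitz (P : Potential) (hε : 0 < ε) {t : ℕ} (ht : 1 ≤ t)
    {x y : ℝ} (hx : x ∈ Set.Icc (0 : ℝ) t) (hy : y ∈ Set.Icc (0 : ℝ) t) :
    |coinBet (P.fn ε) (t + 1) x - coinBet (P.fn ε) (t + 1) y| ≤ P.lip ε t * |x - y| := by
  rcases le_total y x with h | h
  · rw [abs_of_nonneg (sub_nonneg.2 h)]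
    exact P.coinBet_lipschitz_of_le hε ht hy.1 h hx.2
  · rw [abs_sub_comm, abs_sub_comm x y, abs_of_nonneg (sub_nonneg.2 h)]
    exact P.coinBet_lipschitz_of_le hε ht hx.1 h hy.2

/-- The geometric rate of the consensus error under the linear schedule. -/
def Potential.rate : Potential → ℝ
  | .KT => 1 / 4
  | .SE => Real.exp (-(3 / 2))

theorem Potential.rate_pos (P : Potential) : 0 < P.rate := by
  cases P <;> simp only [Potential.rate] <;> positivity

theorem Potential.rate_le (P : Potential) : P.rate ≤ 1 / 2 := by
  cases P with
  | KT => norm_num [Potential.rate]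
  | SE =>
    rw [Potential.rate, Real.exp_neg, inv_le_comm₀ (Real.exp_pos _) (by norm_num)]
    linarith [Real.add_one_le_exp (3 / 2 : ℝ)]

theorem sum_pow_half_le (x : ℝ) (h0 : 0 ≤ x) (h1 : x ≤ 1 / 2) (n : ℕ) :
    ∑ s ∈ Finset.range n, x ^ s ≤ 2 := by
  have hs := summable_geometric_of_lt_one h0 (by linarith)
  calc _ ≤ ∑' s, x ^ s := hs.sum_le_tsum _ fun _ _ => by positivity
    _ = (1 - x)⁻¹ := tsum_geometric_of_lt_one h0 (by linarith)
    _ ≤ 2 := by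
      rw [inv_le_comm₀ (by linarith) (by norm_num)]
      linarith

/-- The decay beats the Lipschitz growth: the terms are multiples of `2^{-s}` (KT) or `e^{-s}` (SE).
The index is shifted because the state of round `s + 1` has passed through the `q(s)` substeps of
round `s`. -/
theorem Potential.sum_lip_mul_rate_le (P : Potential) (hε : 0 < ε) (n : ℕ) :
    ∑ s ∈ Finset.range n, P.lip ε (s + 1) * P.rate ^ s ≤ P.schedConst ε / 4 := by
  cases P with
  | KT =>
    have e : ∀ s : ℕ, Potential.KT.lip ε (s + 1) * Potential.KT.rate ^ s
        = 16 / 3 * ε * (1 / 2) ^ s := by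
      intro s
      simp only [Potential.lip, Potential.rate]
      rw [show (1 / 4 : ℝ) = 1 / 2 * (1 / 2) by norm_num, mul_pow, pow_succ]
      have : (2 : ℝ) ^ s * (1 / 2) ^ s = 1 := by rw [← mul_pow]; norm_num
      linear_combination (16 / 3 * ε * (1 / 2) ^ s) * this
    simp only [e, ← Finset.mul_sum, Potential.schedConst]
    have h := sum_pow_half_le (1 / 2) (by norm_num) le_rfl n
    have hlog : 0 ≤ 2 / Real.log 2 := by positivity
    have h2 := mul_le_mul_of_nonneg_left h (show 0 ≤ 16 / 3 * ε by positivity)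
    have h3 : 0 ≤ (ε + 1) * (2 / Real.log 2) := by positivity
    linarith
  | SE =>
    have e : ∀ s : ℕ, Potential.SE.lip ε (s + 1) * Potential.SE.rate ^ s
        = 2 * ε * Real.exp (1 / 2) * Real.exp (-1) ^ s := by
      intro s
      simp only [Potential.lip, Potential.rate]
      rw [← Real.exp_nat_mul, ← Real.exp_nat_mul, mul_assoc, mul_assoc (2 * ε), ← Real.exp_add,
        ← Real.exp_add]
      congr 2
      push_cast
      ring
    simp only [e, ← Finset.mul_sum, Potential.schedConst]
    have he1 := Real.add_one_le_exp (1 : ℝ)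
    have h := sum_pow_half_le (Real.exp (-1)) (Real.exp_pos _).le
      (by rw [Real.exp_neg, inv_le_comm₀ (Real.exp_pos _) (by norm_num)]; linarith) n
    have h2 := mul_le_mul_of_nonneg_left h (show 0 ≤ 2 * ε * Real.exp (1 / 2) by positivity)
    have h3 : Real.exp (3 / 2) = Real.exp 1 * Real.exp (1 / 2) := by
      rw [← Real.exp_add]; norm_num
    have h4 : 2 * Real.exp (1 / 2) ≤ Real.exp (3 / 2) := by
      rw [h3]
      exact mul_le_mul_of_nonneg_right (by linarith) (Real.exp_pos _).le
    nlinarith [mul_le_mul_of_nonneg_left h4 hε.le, Real.exp_pos (3 / 2 : ℝ)]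

section Regret

variable {H : Type*} [NormedAddCommGroup H] [InnerProductSpace ℝ H] {ε : ℝ}

/-! ### Radial maps -/

theorem norm_radial_le (a : ℝ) (G : H) : ‖(a / ‖G‖) • G‖ ≤ |a| := by
  rw [norm_smul, Real.norm_eq_abs, abs_div, abs_norm]
  rcases (norm_nonneg G).eq_or_lt with h | h
  · rw [← h]
    simp
  · rw [div_mul_cancel₀ _ h.ne']

/-- Radial lifts keep the Lipschitz constant. With `κ` the cosine of the angle, the squared distance
of the images is `(a - b)² + 2ab(1 - κ)`; each term is compared with its counterpart for `r` and
`s`, using `ab ≤ L² r s`. -/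
theorem norm_radial_sub_radial_le {φ : ℝ → ℝ} {R L : ℝ} (hL : 0 ≤ L) (hφ0 : φ 0 = 0)
    (hφ : ∀ x ∈ Set.Icc 0 R, ∀ y ∈ Set.Icc 0 R, |φ x - φ y| ≤ L * |x - y|) {G G' : H}
    (hG : ‖G‖ ≤ R) (hG' : ‖G'‖ ≤ R) :
    ‖(φ ‖G‖ / ‖G‖) • G - (φ ‖G'‖ / ‖G'‖) • G'‖ ≤ L * ‖G - G'‖ := by
  have hR : 0 ≤ R := (norm_nonneg G).trans hG
  have hbound : ∀ x ∈ Set.Icc 0 R, |φ x| ≤ L * x := by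
    intro x hx
    have := hφ x hx 0 ⟨le_rfl, hR⟩
    rwa [hφ0, sub_zero, sub_zero, abs_of_nonneg hx.1] at this
  rcases eq_or_ne G 0 with rfl | h
  · rw [smul_zero, zero_sub, zero_sub, norm_neg, norm_neg]
    exact (norm_radial_le _ _).trans (hbound _ ⟨norm_nonneg _, hG'⟩)
  rcases eq_or_ne G' 0 with rfl | h'
  · rw [smul_zero, sub_zero, sub_zero]
    exact (norm_radial_le _ _).trans (hbound _ ⟨norm_nonneg _, hG⟩)
  have hr : 0 < ‖G‖ := norm_pos_iff.2 h
  have hs : 0 < ‖G'‖ := norm_pos_iff.2 h'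
  have hlip := hφ ‖G‖ ⟨hr.le, hG⟩ ‖G'‖ ⟨hs.le, hG'⟩
  have ha := hbound ‖G‖ ⟨hr.le, hG⟩
  have hb := hbound ‖G'‖ ⟨hs.le, hG'⟩
  apply le_of_sq_le_sq _ (by positivity)
  rw [mul_pow, norm_sub_sq_real, norm_sub_sq_real, norm_smul, norm_smul, real_inner_smul_left,
    real_inner_smul_right]
  have hc := real_inner_le_norm G G'
  set r := ‖G‖
  set s := ‖G'‖
  set a := φ r
  set b := φ s
  set c := ⟪G, G'⟫
  rw [Real.norm_eq_abs, Real.norm_eq_abs, mul_pow, mul_pow, sq_abs, sq_abs]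
  have e1 : (a / r) ^ 2 * r ^ 2 = a ^ 2 := by field_simp
  have e2 : (b / s) ^ 2 * s ^ 2 = b ^ 2 := by field_simp
  have e3 : a / r * (b / s * c) = a * b * (c / (r * s)) := by field_simp
  have e4 : c = r * s * (c / (r * s)) := by field_simp
  rw [e1, e2, e3]
  have hκ : c / (r * s) ≤ 1 := by
    rw [div_le_one (by positivity)]
    exact hc
  nth_rewrite 2 [e4]
  set κ := c / (r * s)
  have hab : a * b ≤ L ^ 2 * (r * s) := by
    calc a * b ≤ |a| * |b| := by rw [← abs_mul]; exact le_abs_self _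
      _ ≤ (L * r) * (L * s) := mul_le_mul ha hb (abs_nonneg _) (by positivity)
      _ = _ := by ring
  have hsq : (a - b) ^ 2 ≤ L ^ 2 * (r - s) ^ 2 := by
    rw [← sq_abs (a - b), ← sq_abs (r - s), ← mul_pow]
    exact pow_le_pow_left₀ (abs_nonneg _) hlip 2
  nlinarith [mul_le_mul_of_nonneg_right hab (sub_nonneg.2 hκ)]

theorem bet_eq_radial (F : ℕ → ℝ → ℝ) (t : ℕ) (G : H) :
    bet F t G = (coinBet F t ‖G‖ / ‖G‖) • G := by
  unfold bet
  split_ifs with h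
  · rw [h, smul_zero]
  · rfl

theorem clip_eq_radial (R : ℝ) (G : H) : clip R G = (min ‖G‖ R / ‖G‖) • G := by
  unfold clip
  split_ifs with h
  · rcases eq_or_ne G 0 with rfl | h0
    · simp
    · rw [min_eq_left h, div_self (norm_ne_zero_iff.2 h0), one_smul]
  · rw [min_eq_right (not_le.1 h).le]

theorem norm_clip_le {R : ℝ} (hR : 0 ≤ R) (G : H) : ‖clip R G‖ ≤ R := by
  rw [clip_eq_radial]
  refine (norm_radial_le _ _).trans ?_
  rw [abs_of_nonneg (le_min (norm_nonneg _) hR)]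
  exact min_le_right _ _

theorem norm_clip_sub_clip_le {R : ℝ} (hR : 0 ≤ R) (G G' : H) :
    ‖clip R G - clip R G'‖ ≤ ‖G - G'‖ := by
  rw [clip_eq_radial, clip_eq_radial, ← one_mul ‖G - G'‖]
  -- The radius of the lemma is the larger of the two norms, so it imposes no restriction here.
  refine norm_radial_sub_radial_le (φ := fun x => min x R) (R := max ‖G‖ ‖G'‖) zero_le_one
    (min_eq_left hR) (fun x _ y _ => ?_) (le_max_left _ _) (le_max_right _ _)
  rw [one_mul]
  simpa using abs_min_sub_min_le_max x R y R

theorem Potential.norm_bet_sub_bet_le (P : Potential) (hε : 0 < ε) {t : ℕ} (ht : 1 ≤ t)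
    {G G' : H} (hG : ‖G‖ ≤ t) (hG' : ‖G'‖ ≤ t) :
    ‖bet (P.fn ε) (t + 1) G - bet (P.fn ε) (t + 1) G'‖ ≤ P.lip ε t * ‖G - G'‖ := by
  rw [bet_eq_radial, bet_eq_radial]
  exact norm_radial_sub_radial_le (P.lip_nonneg hε t) (P.coinBet_zero t)
    (fun x hx y hy => P.coinBet_lipschitz hε ht hx hy) hG hG'

theorem bet_zero (F : ℕ → ℝ → ℝ) (t : ℕ) : bet F t (0 : H) = 0 := if_pos rfl

theorem Potential.norm_bet_clip_sub_le (P : Potential) (hε : 0 < ε) (t : ℕ) (G G' : H) :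
    ‖bet (P.fn ε) (t + 1) (clip (t : ℝ) G) - bet (P.fn ε) (t + 1) (clip (t : ℝ) G')‖
      ≤ P.lip ε t * ‖G - G'‖ := by
  rcases Nat.eq_zero_or_pos t with rfl | ht
  -- The Lipschitz estimate for betting requires `t ≥ 1`; in round `0` everything is clipped to the
  -- origin.
  · have h : ∀ G : H, clip ((0 : ℕ) : ℝ) G = 0 := fun G =>
      norm_le_zero_iff.1 (by simpa using norm_clip_le (R := ((0 : ℕ) : ℝ)) (by simp) G)
    rw [h, h, sub_self, norm_zero]
    exact mul_nonneg (P.lip_nonneg hε 0) (norm_nonneg _)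
  · exact (P.norm_bet_sub_bet_le hε ht (norm_clip_le (Nat.cast_nonneg t) _)
      (norm_clip_le (Nat.cast_nonneg t) _)).trans (mul_le_mul_of_nonneg_left
      (norm_clip_sub_clip_le (Nat.cast_nonneg t) _ _) (P.lip_nonneg hε t))

theorem Potential.norm_bet_clip_le (P : Potential) (hε : 0 < ε) (t : ℕ) (G : H) :
    ‖bet (P.fn ε) (t + 1) (clip (t : ℝ) G)‖ ≤ P.lip ε t * t := by
  have ht := Nat.cast_nonneg (α := ℝ) t
  have hcc : clip (t : ℝ) (clip (t : ℝ) G) = clip (t : ℝ) G := if_pos (norm_clip_le ht G)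
  have h0 : clip (t : ℝ) (0 : H) = 0 := if_pos (by simp)
  have h := P.norm_bet_clip_sub_le hε t (clip (t : ℝ) G) 0
  rw [h0, bet_zero, sub_zero, sub_zero, hcc] at h
  exact h.trans (mul_le_mul_of_nonneg_left (norm_clip_le ht G) (P.lip_nonneg hε t))

/-! ### Regret of the ideal coin bettor -/

/-- The coin `c` acts like a sign with mean `τ`, its component along `G`: `‖G + c‖²` is at most the
average of `(‖G‖ ± 1)²` with weights `(1 ± τ)/2`. Monotonicity and convexity in the squared norm
bound the potential by the same average of its two values, and `a + b ≤ 2m` converts this into `m`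
plus the gain of the bet. -/
theorem Potential.fn_succ_norm_add_le (P : Potential) (hε : 0 < ε) {t : ℕ} {G c : H}
    (hG : ‖G‖ ≤ t) (hc : ‖c‖ ≤ 1) :
    P.fn ε (t + 1) ‖G + c‖ ≤ P.fn ε t ‖G‖ + ⟪c, bet (P.fn ε) (t + 1) G⟫ := by
  have ht : (0 : ℝ) ≤ t := Nat.cast_nonneg t
  have hx1 : |‖G‖| < (t : ℝ) + 1 := by rw [abs_norm]; linarith
  have havg := P.fn_succ_add_le hε hx1
  rcases eq_or_ne G 0 with rfl | h0
  · rw [bet_zero, inner_zero_right, zero_add, add_zero]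
    rw [norm_zero, zero_add, zero_sub, P.fn_neg] at havg
    have := P.fn_le_fn hε (t := t + 1) (x := ‖c‖) (y := 1) (by simpa using hc)
      (by rw [abs_one]; push_cast; linarith)
    rw [norm_zero]
    linarith
  have hx : 0 < ‖G‖ := norm_pos_iff.2 h0
  have hin := abs_real_inner_le_norm c G
  rw [bet_eq_radial, real_inner_smul_right, P.coinBet_succ, bettingFraction]
  have hnorm : ‖G + c‖ ^ 2 = ‖G‖ ^ 2 + 2 * ⟪c, G⟫ + ‖c‖ ^ 2 := by
    rw [norm_add_sq_real, real_inner_comm]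
  have hGc : ‖G + c‖ ≤ ‖G‖ + 1 := (norm_add_le _ _).trans (by linarith)
  have hGcnn := norm_nonneg (G + c)
  have hcnn := norm_nonneg c
  set x := ‖G‖
  set τ := ⟪c, G⟫ / x with hτ
  have hτx : ⟪c, G⟫ = τ * x := by rw [hτ]; field_simp
  have hτ1 : |τ| ≤ 1 := by
    rw [hτ, abs_div, abs_of_pos hx, div_le_one hx]
    nlinarith
  obtain ⟨hτl, hτu⟩ := abs_le.1 hτ1
  set a := P.fn ε (t + 1) (x + 1) with ha
  set b := P.fn ε (t + 1) (x - 1) with hb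
  have hcast : ((t + 1 : ℕ) : ℝ) = t + 1 := by push_cast; ring
  have hapos : 0 < a := P.fn_pos hε (by rw [abs_of_pos (by linarith), hcast]; linarith)
  have hbpos : 0 < b := P.fn_pos hε (by rw [abs_lt, hcast]; constructor <;> linarith)
  set z : ℝ := (1 + τ) / 2 * (x + 1) ^ 2 + (1 - τ) / 2 * (x - 1) ^ 2 with hz
  have hz' : z = x ^ 2 + 2 * (τ * x) + 1 := by rw [hz]; ring
  have hmem : ∀ y : ℝ, |y| < t + 2 → y ^ 2 ∈ Set.Ico 0 ((((t + 1 : ℕ) : ℝ) + 1) ^ 2) := by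
    intro y hy
    refine ⟨sq_nonneg _, sq_lt_sq.2 ?_⟩
    rw [hcast, abs_of_pos (show (0 : ℝ) < t + 1 + 1 by linarith)]
    linarith
  have hconv := (P.fn_sqrt_convexOn hε (t + 1)).2
    (hmem (x + 1) (by rw [abs_of_pos (by linarith)]; linarith))
    (hmem (x - 1) (by rw [abs_lt]; constructor <;> linarith))
    (show 0 ≤ (1 + τ) / 2 by linarith) (show 0 ≤ (1 - τ) / 2 by linarith) (by ring)
  simp only [smul_eq_mul, P.fn_sqrt_sq, ← hz, ← ha, ← hb] at hconv
  have hz0 : ‖G + c‖ ^ 2 ≤ z := by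
    rw [hnorm, hτx, hz']
    nlinarith
  have hzle : z ≤ (x + 1) ^ 2 := by rw [hz']; nlinarith
  have hsz : √z ≤ x + 1 := Real.sqrt_le_iff.2 ⟨by linarith, hzle⟩
  have hmono : P.fn ε (t + 1) ‖G + c‖ ≤ P.fn ε (t + 1) √z := by
    apply P.fn_le_fn hε
    · rw [abs_of_nonneg hGcnn, abs_of_nonneg (Real.sqrt_nonneg _)]
      exact Real.le_sqrt_of_sq_le hz0
    · rw [abs_of_nonneg (Real.sqrt_nonneg _), hcast]
      linarith
  set m := P.fn ε t x
  have hab : 0 < a + b := by linarith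
  have hgoal : (1 + τ) / 2 * a + (1 - τ) / 2 * b ≤ m * (1 + (a - b) / (a + b) * τ) := by
    have e : 1 + (a - b) / (a + b) * τ = 2 * ((1 + τ) / 2 * a + (1 - τ) / 2 * b) / (a + b) := by
      field_simp
      ring
    have hnn : 0 ≤ (1 + τ) / 2 * a + (1 - τ) / 2 * b :=
      add_nonneg (mul_nonneg (by linarith) hapos.le) (mul_nonneg (by linarith) hbpos.le)
    -- The betting fraction makes `1 + βτ` proportional to the weighted average of `a` and `b`; only
    -- `a + b ≤ 2m` remains.
    rw [e, mul_div_assoc', le_div_iff₀ hab]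
    exact (mul_le_mul_of_nonneg_left havg hnn).trans_eq (by ring)
  rw [hτx]
  have e2 : (a - b) / (a + b) * m / x * (τ * x) = m * ((a - b) / (a + b) * τ) := by field_simp
  rw [e2]
  linarith

theorem norm_neg_sum_le {g : ℕ → H} (hg : ∀ t, ‖g t‖ ≤ 1) (T : ℕ) :
    ‖-∑ s ∈ Finset.range T, g s‖ ≤ T := by
  rw [norm_neg]
  calc _ ≤ ∑ s ∈ Finset.range T, (1 : ℝ) := norm_sum_le_of_le _ fun s _ => hg s
    _ = T := by simp

/-- The one-step inequality telescopes with coins `-g t`, starting from `F_0(0) = ε`. -/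
theorem Potential.sum_inner_bet_le (P : Potential) (hε : 0 < ε) {g : ℕ → H}
    (hg : ∀ t, ‖g t‖ ≤ 1) (T : ℕ) :
    ∑ t ∈ Finset.range T, ⟪g t, bet (P.fn ε) (t + 1) (-∑ s ∈ Finset.range t, g s)⟫
      ≤ ε - P.fn ε T ‖-∑ s ∈ Finset.range T, g s‖ := by
  induction T with
  | zero => simp [P.fn_zero]
  | succ T ih =>
    have h := P.fn_succ_norm_add_le hε (t := T) (norm_neg_sum_le hg T)
      (show ‖-g T‖ ≤ 1 by rw [norm_neg]; exact hg T)
    rw [inner_neg_left, ← neg_add, ← Finset.sum_range_succ] at h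
    rw [Finset.sum_range_succ]
    linarith

/-- Reward-regret duality through Cauchy-Schwarz. `closedForm` includes the communication cost, so
`regConst * √T` is taken out and left to pay for consensus errors. -/
theorem Potential.sum_inner_bet_sub_le (P : Potential) (hε : 0 < ε) {g : ℕ → H}
    (hg : ∀ t, ‖g t‖ ≤ 1) (u : H) {T : ℕ} (hT : 1 ≤ T) (N : ℕ) (μ : ℝ) :
    ∑ t ∈ Finset.range T, ⟪g t, bet (P.fn ε) (t + 1) (-∑ s ∈ Finset.range t, g s) - u⟫
      ≤ P.closedForm ε N μ T ‖u‖ - P.regConst ε N μ * √T := by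
  have h1 := P.sum_inner_bet_le hε hg T
  have h2 := P.add_mul_sub_fn_le hε hT (norm_nonneg _) (norm_neg_sum_le hg T) (norm_nonneg u) N μ
  have h3 := real_inner_le_norm (-∑ s ∈ Finset.range T, g s) u
  simp only [inner_sub_right, Finset.sum_sub_distrib]
  rw [← sum_inner]
  rw [inner_neg_left] at h3
  linarith

/-! ### From the ideal bettor to the network -/

variable {N : ℕ}

theorem IsSubgradient.norm_le_one {f : H → ℝ} {x g : H} (h : IsSubgradient f x g)
    (hf : LipschitzWith 1 f) : ‖g‖ ≤ 1 := by
  have h1 := h (x + g)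
  rw [add_sub_cancel_left, real_inner_self_eq_norm_sq] at h1
  have h2 := hf.dist_le_mul (x + g) x
  rw [dist_eq_norm, dist_eq_norm, add_sub_cancel_left, NNReal.coe_one, one_mul,
    Real.norm_eq_abs] at h2
  have h3 := le_abs_self (f (x + g) - f x)
  by_contra! h4
  nlinarith

theorem abs_sub_le_of_lipschitzWith_one {f : H → ℝ} (hf : LipschitzWith 1 f) (x y : H) :
    |f x - f y| ≤ ‖x - y‖ := by
  simpa [dist_eq_norm] using hf.dist_le_mul x y

theorem abs_networkLoss_sub_le (hN : 0 < N) {ℓ : Fin N → H → ℝ}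
    (hℓ : ∀ n, LipschitzWith 1 (ℓ n)) (x y : H) :
    |networkLoss ℓ x - networkLoss ℓ y| ≤ ‖x - y‖ := by
  have hN' : (0 : ℝ) < N := by exact_mod_cast hN
  rw [networkLoss, networkLoss, ← sub_div, ← Finset.sum_sub_distrib, abs_div, abs_of_pos hN',
    div_le_iff₀ hN']
  calc _ ≤ ∑ n, |ℓ n x - ℓ n y| := Finset.abs_sum_le_sum_abs _ _
    _ ≤ ∑ _n : Fin N, ‖x - y‖ :=
      Finset.sum_le_sum fun n _ => abs_sub_le_of_lipschitzWith_one (hℓ n) x y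
    _ = _ := by simp [mul_comm]

/-- Agent `m` has its subgradient at `x m`, not at `x n` or `X`. Moving from `x n` to `x m` costs
`‖x n - X‖ + ‖x m - X‖`, replacing `x m` by `X` in the linear term costs `‖x m - X‖` more; averaging
gives the factor `3`. -/
theorem average_networkLoss_sub_le (hN : 0 < N) {ℓ : Fin N → H → ℝ}
    (hℓ : ∀ n, LipschitzWith 1 (ℓ n)) {x g : Fin N → H}
    (hg : ∀ n, IsSubgradient (ℓ n) (x n) (g n)) (X u : H) :
    (∑ n, networkLoss ℓ (x n)) / N - networkLoss ℓ u
      ≤ ⟪mean g, X - u⟫ + 3 / N * ∑ n, ‖x n - X‖ := by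
  have hN' : (0 : ℝ) < N := by exact_mod_cast hN
  have hpt : ∀ n m, ℓ m (x n)
      ≤ ℓ m u + ⟪g m, X - u⟫ + 2 * ‖x m - X‖ + ‖x n - X‖ := by
    intro n m
    have h1 := le_of_abs_le (abs_sub_le_of_lipschitzWith_one (hℓ m) (x n) (x m))
    have h2 : ‖x n - x m‖ ≤ ‖x n - X‖ + ‖x m - X‖ := by
      rw [norm_sub_rev (x m)]
      exact norm_sub_le_norm_sub_add_norm_sub _ _ _
    have h3 := hg m u
    have h4 : ⟪g m, u - x m⟫ = -⟪g m, X - u⟫ - ⟪g m, x m - X⟫ := by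
      simp only [inner_sub_right]
      ring
    have h5 : ⟪g m, x m - X⟫ ≤ ‖x m - X‖ := by
      refine (real_inner_le_norm _ _).trans ?_
      exact mul_le_of_le_one_left (norm_nonneg _) ((hg m).norm_le_one (hℓ m))
    linarith
  have hsum : ∑ n, ∑ m, ℓ m (x n) ≤ ∑ n, ∑ m,
      (ℓ m u + ⟪g m, X - u⟫ + 2 * ‖x m - X‖ + ‖x n - X‖) :=
    Finset.sum_le_sum fun n _ => Finset.sum_le_sum fun m _ => hpt n m
  simp only [Finset.sum_add_distrib, Finset.sum_const, Finset.card_univ, Fintype.card_fin,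
    nsmul_eq_mul, ← Finset.mul_sum] at hsum
  simp only [networkLoss, mean, ← Finset.sum_div, real_inner_smul_left, sum_inner]
  rw [← sub_nonneg]
  have e : (N : ℝ)⁻¹ * ∑ m, ⟪g m, X - u⟫ + 3 / N * ∑ n, ‖x n - X‖
      - ((∑ n, ∑ m, ℓ m (x n)) / N / N - (∑ m, ℓ m u) / N)
      = (N * (∑ m, ℓ m u) + N * ∑ m, ⟪g m, X - u⟫ + N * (2 * ∑ n, ‖x n - X‖)
        + N * ∑ n, ‖x n - X‖ - ∑ n, ∑ m, ℓ m (x n)) / (N * N) := by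
    field_simp
    ring
  rw [e]
  apply div_nonneg _ (by positivity)
  linarith

variable {𝒢 : SimpleGraph (Fin N)} {W : Matrix (Fin N) (Fin N) ℝ} {Ω : Type*} {γ : ℝ}

/-- Pathwise regret: ideal bound plus the weighted consensus errors. -/
theorem IsGossipMatrix.networkRegret_le (hW : IsGossipMatrix 𝒢 W) (hN : 0 < N) (P : Potential)
    (hε : 0 < ε) (C : Ω → H → H) (q : ℕ → ℕ) (w : ℕ → ℕ → Fin N → Ω) (g : ℕ → Fin N → H)
    {ℓ : ℕ → Fin N → H → ℝ} (hℓ : ∀ t n, LipschitzWith 1 (ℓ t n))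
    (hg : ∀ t n, IsSubgradient (ℓ t n) (prediction (P.fn ε) W γ C q w g t n) (g t n))
    (u : H) {T : ℕ} (hT : 1 ≤ T) (μ : ℝ) :
    networkRegret ℓ (prediction (P.fn ε) W γ C q w g) u T
      ≤ P.closedForm ε N μ T ‖u‖ - P.regConst ε N μ * √T
        + ∑ t ∈ Finset.range T, 3 * P.lip ε t / √N * networkNorm (dev (state W γ C q w g t).1) := by
  have hN' : (0 : ℝ) < N := by exact_mod_cast hN
  have hg1 : ∀ t n, ‖g t n‖ ≤ 1 := fun t n => (hg t n).norm_le_one (hℓ t n)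
  have hm1 : ∀ t, ‖mean (g t)‖ ≤ 1 := fun t => norm_mean_le_of_forall_le zero_le_one (hg1 t)
  refine le_trans ?_ (add_le_add_left (P.sum_inner_bet_sub_le hε hm1 u hT N μ) _)
  rw [networkRegret, ← Finset.sum_sub_distrib, ← Finset.sum_add_distrib]
  refine Finset.sum_le_sum fun t _ => ?_
  refine (average_networkLoss_sub_le hN (hℓ t) (hg t)
    (bet (P.fn ε) (t + 1) (-∑ s ∈ Finset.range t, mean (g s))) u).trans ?_
  refine add_le_add_right ?_ _
  set S := (state W γ C q w g t).1
  have hmean : -∑ s ∈ Finset.range t, mean (g s) = mean S := (hW.mean_state C q w g t).symm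
  -- A sum of `t` mean gradients has norm at most `t`, so clipping never touches the ideal
  -- trajectory.
  have hclip : clip (t : ℝ) (mean S) = mean S := by
    rw [← hmean]
    exact if_pos (norm_neg_sum_le hm1 t)
  rw [hmean]
  have h1 : ∑ n, ‖prediction (P.fn ε) W γ C q w g t n - bet (P.fn ε) (t + 1) (mean S)‖
      ≤ P.lip ε t * (√N * networkNorm (dev S)) := by
    calc _ ≤ ∑ n, P.lip ε t * ‖dev S n‖ := by
          refine Finset.sum_le_sum fun n _ => ?_
          have := P.norm_bet_clip_sub_le hε t (S n) (mean S)
          rwa [hclip] at this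
      _ = P.lip ε t * ∑ n, ‖dev S n‖ := by rw [Finset.mul_sum]
      _ ≤ _ := mul_le_mul_of_nonneg_left (sum_norm_le_sqrt_mul_networkNorm _) (P.lip_nonneg hε t)
  calc _ ≤ 3 / N * (P.lip ε t * (√N * networkNorm (dev S))) :=
        mul_le_mul_of_nonneg_left h1 (by positivity)
    _ = 3 * P.lip ε t * networkNorm (dev S) * (√N / N) := by ring
    _ = _ := by
      rw [Real.sqrt_div_self]
      ring

end Regret

section Measurability

variable {H : Type*} [NormedAddCommGroup H] [InnerProductSpace ℝ H] {N : ℕ}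
  {Ω : Type*} [MeasurableSpace Ω] {Ω₀ : Type*} {ξ : ℕ → ℕ → Fin N → Ω₀ → Ω}

/-! ### The filtration of the compressor randomness -/

/-- Everything generated by the draws before substep `k` of round `t`. -/
@[reducible] def past (ξ : ℕ → ℕ → Fin N → Ω₀ → Ω) (t k : ℕ) : MeasurableSpace Ω₀ :=
  ⨆ p ∈ {p : ℕ × ℕ | p.1 < t ∨ p.1 = t ∧ p.2 < k},
    MeasurableSpace.comap (fun (ω : Ω₀) (n : Fin N) => ξ p.1 p.2 n ω) inferInstance

theorem measurable_past {s j t k : ℕ} (h : s < t ∨ s = t ∧ j < k) (n : Fin N) :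
    Measurable[past ξ t k] (ξ s j n) := by
  have h1 : Measurable[MeasurableSpace.comap (fun (ω : Ω₀) (n : Fin N) => ξ s j n ω)
      inferInstance] (ξ s j n) :=
    (measurable_pi_apply n).comp (comap_measurable (fun (ω : Ω₀) (n : Fin N) => ξ s j n ω))
  refine h1.mono ?_ le_rfl
  exact le_iSup₂_of_le (f := fun (p : ℕ × ℕ) (_ : p ∈ {p : ℕ × ℕ | p.1 < t ∨ p.1 = t ∧ p.2 < k}) =>
    MeasurableSpace.comap (fun (ω : Ω₀) (n : Fin N) => ξ p.1 p.2 n ω) inferInstance)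
    (s, j) h le_rfl

theorem measurable_history {s t : ℕ} (h : s < t) (k : ℕ) (n : Fin N) :
    Measurable[history ξ t] (ξ s k n) := by
  rw [measurable_iff_comap_le]
  exact le_iSup_of_le s (le_iSup_of_le h (le_iSup_of_le k (le_iSup_of_le n le_rfl)))

theorem history_le_past (t k : ℕ) : history ξ t ≤ past ξ t k :=
  iSup_le fun _ => iSup_le fun hs => iSup_le fun _ => iSup_le fun n =>
    (measurable_past (Or.inl hs) n).comap_le

theorem past_le_past_succ (t k : ℕ) : past ξ t k ≤ past ξ t (k + 1) := by
  refine iSup₂_le fun p hp => le_iSup₂_of_le p ?_ le_rfl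
  exact hp.imp_right fun h => ⟨h.1, h.2.trans (Nat.lt_succ_self k)⟩

theorem past_le_history (t k : ℕ) : past ξ t k ≤ history ξ (t + 1) := by
  refine iSup₂_le fun p hp => Measurable.comap_le ?_
  refine @measurable_pi_lambda _ _ _ (history ξ (t + 1)) _ _ fun n => measurable_history ?_ _ n
  rcases hp with h | h
  · omega
  · omega

/-! ### Measurability of network states -/

theorem stronglyMeasurable_networkNorm {m : MeasurableSpace Ω₀} {Z : Ω₀ → Fin N → H}
    (hZ : ∀ n, StronglyMeasurable[m] fun ω => Z ω n) :
    StronglyMeasurable[m] fun ω => networkNorm (Z ω) := by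
  refine Real.continuous_sqrt.comp_stronglyMeasurable ?_
  exact Finset.stronglyMeasurable_fun_sum _ fun n _ => (hZ n).norm.pow 2

/-- A random state is `m`-measurable, agent by agent. -/
def IsMeasurableState (m : MeasurableSpace Ω₀) (S : Ω₀ → (Fin N → H) × (Fin N → H)) : Prop :=
  ∀ n, StronglyMeasurable[m] (fun ω => (S ω).1 n) ∧ StronglyMeasurable[m] (fun ω => (S ω).2 n)

theorem IsMeasurableState.mono {m m' : MeasurableSpace Ω₀}
    {S : Ω₀ → (Fin N → H) × (Fin N → H)} (hS : IsMeasurableState m S) (h : m ≤ m') :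
    IsMeasurableState m' S := fun n => ⟨(hS n).1.mono h, (hS n).2.mono h⟩

theorem IsMeasurableState.dev {m : MeasurableSpace Ω₀} {S : Ω₀ → (Fin N → H) × (Fin N → H)}
    (hS : IsMeasurableState m S) :
    StronglyMeasurable[m] (fun ω => networkNorm (DecoEF.dev (S ω).1)) := by
  refine stronglyMeasurable_networkNorm fun n => (hS n).1.sub ?_
  exact (Finset.stronglyMeasurable_fun_sum _ fun j _ => (hS j).1).const_smul _

theorem IsMeasurableState.sub {m : MeasurableSpace Ω₀} {S : Ω₀ → (Fin N → H) × (Fin N → H)}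
    (hS : IsMeasurableState m S) :
    StronglyMeasurable[m] (fun ω => networkNorm ((S ω).1 - (S ω).2)) :=
  stronglyMeasurable_networkNorm fun n => (hS n).1.sub (hS n).2

variable [MeasurableSpace H] [BorelSpace H] {C : Ω → H → H} {α : ℝ} {ν : Measure Ω}
  {W : Matrix (Fin N) (Fin N) ℝ} {γ : ℝ}

/-- `H` need not be separable, but a strongly measurable `D` has separable range, and joint
measurability is available there. -/
theorem IsCompressor.stronglyMeasurable_comp (hC : IsCompressor ν C α) {m : MeasurableSpace Ω₀}
    {X : Ω₀ → Ω} (hX : Measurable[m] X) {D : Ω₀ → H} (hD : StronglyMeasurable[m] D) :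
    StronglyMeasurable[m] (fun ω => C (X ω) (D ω)) := by
  have hD' : Measurable[m] (fun ω => (⟨D ω, Set.mem_range_self ω⟩ : Set.range D)) :=
    hD.measurable.subtype_mk
  exact (hC.measurable _ hD.isSeparable_range).comp_measurable (hX.prodMk hD')

theorem IsCompressor.isMeasurableState_gossipStep (hC : IsCompressor ν C α)
    {m : MeasurableSpace Ω₀} {X : Fin N → Ω₀ → Ω} (hX : ∀ n, Measurable[m] (X n))
    {S : Ω₀ → (Fin N → H) × (Fin N → H)} (hS : IsMeasurableState m S) :
    IsMeasurableState m (fun ω => gossipStep W γ C (fun n => X n ω) (S ω)) := by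
  have hhat : ∀ n, StronglyMeasurable[m]
      (fun ω => (gossipStep W γ C (fun n => X n ω) (S ω)).2 n) := fun n =>
    (hS n).2.add (hC.stronglyMeasurable_comp (hX n) ((hS n).1.sub (hS n).2))
  refine fun n => ⟨(hS n).1.add (StronglyMeasurable.const_smul ?_ _), hhat n⟩
  exact Finset.stronglyMeasurable_fun_sum _ fun j _ => ((hhat j).sub (hhat n)).const_smul _

theorem IsCompressor.stronglyMeasurable_compressionResidual (hC : IsCompressor ν C α)
    {m : MeasurableSpace Ω₀} {X : Fin N → Ω₀ → Ω} (hX : ∀ n, Measurable[m] (X n))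
    {S : Ω₀ → (Fin N → H) × (Fin N → H)} (hS : IsMeasurableState m S) :
    StronglyMeasurable[m] (fun ω => networkNorm (compressionResidual C (fun n => X n ω) (S ω))) :=
  stronglyMeasurable_networkNorm fun n => ((hS n).1.sub (hS n).2).sub
    (hC.stronglyMeasurable_comp (hX n) ((hS n).1.sub (hS n).2))

end Measurability

/-! ### Independence of fresh draws and mean-square decay of the consensus error. -/

section Probability

variable {H : Type*} [NormedAddCommGroup H] [InnerProductSpace ℝ H] {N : ℕ}
  {Ω : Type*} [MeasurableSpace Ω] {Ω₀ : Type*} {ξ : ℕ → ℕ → Fin N → Ω₀ → Ω}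
  [MeasurableSpace Ω₀] {P : Measure Ω₀} {ν : Measure Ω}

theorem IsFresh.past_le (hξ : IsFresh P ν ξ) (t k : ℕ) : past ξ t k ≤ ‹MeasurableSpace Ω₀› :=
  iSup₂_le fun p _ => (measurable_pi_lambda _ fun n => hξ.measurable p.1 p.2 n).comap_le

theorem IsFresh.history_le (hξ : IsFresh P ν ξ) (t : ℕ) : history ξ t ≤ ‹MeasurableSpace Ω₀› :=
  (history_le_past t 0).trans (hξ.past_le t 0)

/-- Each substep is one independent block containing all agents; the draw of one agent is a
coordinate of a block outside the past. -/
theorem IsFresh.indep_past (hξ : IsFresh P ν ξ) (t k : ℕ) (n : Fin N) :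
    Indep (MeasurableSpace.comap (ξ t k n) inferInstance) (past ξ t k) P := by
  have h := indep_iSup_of_disjoint
    (fun p : ℕ × ℕ => (measurable_pi_lambda (fun (ω : Ω₀) (n : Fin N) => ξ p.1 p.2 n ω)
      fun n => hξ.measurable p.1 p.2 n).comap_le) hξ.indep.iIndep
    (S := {(t, k)}) (T := {p : ℕ × ℕ | p.1 < t ∨ p.1 = t ∧ p.2 < k}) (by
      rw [Set.disjoint_singleton_left]
      rintro (h | h) <;> simp at h)
  refine indep_of_indep_of_le_left h ?_
  simp only [Set.mem_singleton_iff, iSup_iSup_eq_left]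
  exact ((measurable_pi_apply n).comp (comap_measurable
    (fun (ω : Ω₀) (n : Fin N) => ξ t k n ω))).comap_le

/-! ### Mean-square contraction of the compression residual -/

variable [MeasurableSpace H] [BorelSpace H] {C : Ω → H → H} {α : ℝ}

/-- Mean-square contraction of a fresh compression residual. -/
theorem IsCompressor.lintegral_residual_le [IsProbabilityMeasure ν] [IsProbabilityMeasure P]
    (hC : IsCompressor ν C α) {X : Ω₀ → Ω} (hX : Measurable X) (hlaw : P.map X = ν)
    {D : Ω₀ → H} (hD : StronglyMeasurable D) (hind : IndepFun X D P) :
    ∫⁻ ω, ‖D ω - C (X ω) (D ω)‖ₑ ^ 2 ∂P ≤ ENNReal.ofReal α * ∫⁻ ω, ‖D ω‖ₑ ^ 2 ∂P := by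
  set D' : Ω₀ → Set.range D := fun ω => ⟨D ω, Set.mem_range_self ω⟩ with hD'def
  have hD' : Measurable D' := hD.measurable.subtype_mk
  have hsep := hD.isSeparable_range
  have hXD : IndepFun X D' P := by
    rw [IndepFun_iff_Indep] at hind ⊢
    refine indep_of_indep_of_le_right hind ?_
    exact (MeasurableSpace.comap_comp (f := ((↑) : Set.range D → H)) (g := D')).le
  have hmap := (indepFun_iff_map_prod_eq_prod_map_map hX.aemeasurable hD'.aemeasurable).1 hXD
  rw [hlaw] at hmap
  have hproj : StronglyMeasurable (fun p : Ω × Set.range D => (p.2 : H)) := by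
    refine stronglyMeasurable_iff_measurable_separable.2
      ⟨measurable_subtype_coe.comp measurable_snd, hsep.mono ?_⟩
    rintro _ ⟨p, rfl⟩
    exact p.2.2
  have hf : Measurable (fun p : Ω × Set.range D => ‖C p.1 p.2 - p.2‖ₑ ^ 2) :=
    ((hC.measurable _ hsep).sub hproj).enorm.pow_const 2
  have hprob : IsProbabilityMeasure (P.map D') :=
    Measure.isProbabilityMeasure_map hD'.aemeasurable
  have hg : Measurable (fun d : Set.range D => ‖(d : H)‖ₑ ^ 2) :=
    (measurable_subtype_coe.enorm).pow_const 2
  calc ∫⁻ ω, ‖D ω - C (X ω) (D ω)‖ₑ ^ 2 ∂P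
      = ∫⁻ ω, (fun p : Ω × Set.range D => ‖C p.1 p.2 - p.2‖ₑ ^ 2) (X ω, D' ω) ∂P := by
        refine lintegral_congr fun ω => ?_
        simp only [hD'def]
        rw [enorm_sub_rev]
    _ = ∫⁻ p, ‖C p.1 p.2 - p.2‖ₑ ^ 2 ∂(ν.prod (P.map D')) := by
        rw [← hmap, lintegral_map hf (hX.prodMk hD')]
    -- By independence the joint law is a product, so the input is frozen and the residual bound
    -- applies to the inner integral.
    _ = ∫⁻ d, ∫⁻ x, ‖C x d - d‖ₑ ^ 2 ∂ν ∂(P.map D') := lintegral_prod_symm' _ hf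
    _ ≤ ∫⁻ d, ENNReal.ofReal α * ‖(d : H)‖ₑ ^ 2 ∂(P.map D') :=
        lintegral_mono fun d => hC.residual d
    _ = ENNReal.ofReal α * ∫⁻ ω, ‖D ω‖ₑ ^ 2 ∂P := by
        rw [lintegral_const_mul _ hg, lintegral_map hg hD']

/-! ### Mean-square norms of network vectors -/

theorem enorm_networkNorm_sq (Z : Fin N → H) : ‖networkNorm Z‖ₑ ^ 2 = ∑ n, ‖Z n‖ₑ ^ 2 := by
  rw [Real.enorm_of_nonneg (networkNorm_nonneg Z), ← ENNReal.ofReal_pow (networkNorm_nonneg Z),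
    networkNorm_sq, ENNReal.ofReal_sum_of_nonneg fun n _ => sq_nonneg _]
  refine Finset.sum_congr rfl fun n _ => ?_
  rw [ENNReal.ofReal_pow (norm_nonneg _), ofReal_norm]

theorem eLpNorm_two_sq (f : Ω₀ → ℝ) : eLpNorm f 2 P ^ 2 = ∫⁻ ω, ‖f ω‖ₑ ^ 2 ∂P := by
  have := eLpNorm_nnreal_pow_eq_lintegral (f := f) (μ := P) (p := 2) (by norm_num)
  simpa using this

theorem eLpNorm_two_le_of_lintegral_le {f h : Ω₀ → ℝ} (hα : 0 ≤ α)
    (hfh : ∫⁻ ω, ‖f ω‖ₑ ^ 2 ∂P ≤ ENNReal.ofReal α * ∫⁻ ω, ‖h ω‖ₑ ^ 2 ∂P) {d : ℝ}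
    (hd : eLpNorm h 2 P ≤ ENNReal.ofReal d) :
    eLpNorm f 2 P ≤ ENNReal.ofReal (√α * d) := by
  rw [← eLpNorm_two_sq, ← eLpNorm_two_sq] at hfh
  rw [← ENNReal.pow_le_pow_left_iff (n := 2) two_ne_zero]
  refine hfh.trans ?_
  rw [ENNReal.ofReal_mul (Real.sqrt_nonneg α), mul_pow,
    ← ENNReal.ofReal_pow (Real.sqrt_nonneg α), Real.sq_sqrt hα]
  gcongr

theorem eLpNorm_two_le_of_le_add {f g h : Ω₀ → ℝ} {a b x y : ℝ} (ha : 0 ≤ a) (hb : 0 ≤ b)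
    (hx : 0 ≤ x) (hy : 0 ≤ y)
    (hg : AEStronglyMeasurable g P) (hh : AEStronglyMeasurable h P) (hf0 : ∀ ω, 0 ≤ f ω)
    (hf : ∀ ω, f ω ≤ a * g ω + b * h ω) (hgx : eLpNorm g 2 P ≤ ENNReal.ofReal x)
    (hhy : eLpNorm h 2 P ≤ ENNReal.ofReal y) :
    eLpNorm f 2 P ≤ ENNReal.ofReal (a * x + b * y) := by
  calc eLpNorm f 2 P ≤ eLpNorm (a • g + b • h) 2 P := by
        refine eLpNorm_mono_real (g := a • g + b • h) (fun ω => ?_)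
        rw [Real.norm_of_nonneg (hf0 ω)]
        exact hf ω
    _ ≤ eLpNorm (a • g) 2 P + eLpNorm (b • h) 2 P :=
        eLpNorm_add_le (hg.const_smul a) (hh.const_smul b) (by norm_num)
    _ = ENNReal.ofReal a * eLpNorm g 2 P + ENNReal.ofReal b * eLpNorm h 2 P := by
        rw [eLpNorm_const_smul, eLpNorm_const_smul, Real.enorm_of_nonneg ha,
          Real.enorm_of_nonneg hb]
    _ ≤ ENNReal.ofReal a * ENNReal.ofReal x + ENNReal.ofReal b * ENNReal.ofReal y := by gcongr
    _ = _ := by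
        rw [← ENNReal.ofReal_mul ha, ← ENNReal.ofReal_mul hb, ENNReal.ofReal_add] <;> positivity

/-! ### The Lyapunov function of compressed gossip -/

/-- `b` bounds the mean-square consensus error plus `μ / 4` times the mean-square tracking
error. -/
def LyapunovBound (P : Measure Ω₀) (μ : ℝ) (S : Ω₀ → (Fin N → H) × (Fin N → H)) (b : ℝ) : Prop :=
  ∃ x y : ℝ, 0 ≤ x ∧ 0 ≤ y ∧
    eLpNorm (fun ω => networkNorm (dev (S ω).1)) 2 P ≤ ENNReal.ofReal x ∧
    eLpNorm (fun ω => networkNorm ((S ω).1 - (S ω).2)) 2 P ≤ ENNReal.ofReal y ∧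
    x + μ / 4 * y ≤ b

theorem LyapunovBound.mono {μ : ℝ} {S : Ω₀ → (Fin N → H) × (Fin N → H)} {b b' : ℝ}
    (h : LyapunovBound P μ S b) (hb : b ≤ b') : LyapunovBound P μ S b' := by
  obtain ⟨x, y, hx, hy, h1, h2, h3⟩ := h
  exact ⟨x, y, hx, hy, h1, h2, h3.trans hb⟩

theorem LyapunovBound.integrable_and_integral_le [IsProbabilityMeasure P] {μ : ℝ} (hμ : 0 ≤ μ)
    {S : Ω₀ → (Fin N → H) × (Fin N → H)} {b : ℝ} (h : LyapunovBound P μ S b)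
    (hS : IsMeasurableState ‹MeasurableSpace Ω₀› S) :
    Integrable (fun ω => networkNorm (dev (S ω).1)) P ∧
      ∫ ω, networkNorm (dev (S ω).1) ∂P ≤ b := by
  obtain ⟨x, y, hx, hy, h1, h2, h3⟩ := h
  have hm := hS.dev.aestronglyMeasurable (μ := P)
  have hmem : MemLp (fun ω => networkNorm (dev (S ω).1)) 2 P :=
    ⟨hm, h1.trans_lt ENNReal.ofReal_lt_top⟩
  refine ⟨hmem.integrable (by norm_num), ?_⟩
  have h4 : eLpNorm (fun ω => networkNorm (dev (S ω).1)) 1 P ≤ ENNReal.ofReal x :=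
    (eLpNorm_le_eLpNorm_of_exponent_le (by norm_num) hm).trans h1
  rw [integral_eq_lintegral_of_nonneg_ae (Filter.Eventually.of_forall fun ω =>
    networkNorm_nonneg _) hm]
  rw [eLpNorm_one_eq_lintegral_enorm] at h4
  simp only [Real.enorm_of_nonneg (networkNorm_nonneg _)] at h4
  have h5 := ENNReal.toReal_mono ENNReal.ofReal_ne_top h4
  rw [ENNReal.toReal_ofReal hx] at h5
  nlinarith [mul_nonneg hμ hy]

theorem step_size_condition {γ ρ : ℝ} (hρ1 : ρ < 1)
    (hγ : γ ≤ maxStepSize α (1 - ρ)) :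
    γ * (2 * √α * (1 + 4 / (1 - ρ)) + (1 - ρ) / 2) ≤ 1 - √α := by
  have hμ : 0 < 1 - ρ := by linarith
  have h := hγ.trans (min_le_right _ _)
  rwa [le_div_iff₀ (by positivity)] at h

variable {𝒢 : SimpleGraph (Fin N)} {W : Matrix (Fin N) (Fin N) ℝ} {γ ρ : ℝ}

/-- The errors obey `x' = (1 - γμ)x + 2γ√α y` and `y' = 2γx + (1 + 2γ)√α y`. The weight `μ/4` makes
the coefficient of `x` exactly `1 - γμ/2`, and the required bound on that of `y` is the step-size
condition. Squared residuals add over agents, so dependence between agents is harmless. -/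
theorem IsGossipMatrix.lyapunovBound_gossipStep (hW : IsGossipMatrix 𝒢 W)
    (hρ : IsContractionFactor H W ρ) [IsProbabilityMeasure ν] [IsProbabilityMeasure P]
    (hC : IsCompressor ν C α) (hγ0 : 0 < γ) (hγ : γ ≤ maxStepSize α (1 - ρ))
    (hξ : IsFresh P ν ξ) (t k : ℕ) {S : Ω₀ → (Fin N → H) × (Fin N → H)}
    (hS : IsMeasurableState (past ξ t k) S) {b : ℝ} (h : LyapunovBound P (1 - ρ) S b) :
    LyapunovBound P (1 - ρ) (fun ω => gossipStep W γ C (fun n => ξ t k n ω) (S ω))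
      ((1 - γ * (1 - ρ) / 2) * b) := by
  obtain ⟨x, y, hx, hy, h1, h2, h3⟩ := h
  have hμ : 0 < 1 - ρ := by linarith [hρ.lt_one]
  have hρ0 := hρ.nonneg
  have hγ1 : γ ≤ 1 := hγ.trans (min_le_left _ _)
  have hcond := step_size_condition hρ.lt_one hγ
  have hS' := hS.mono (hξ.past_le t k)
  have hdev := hS'.dev.aestronglyMeasurable (μ := P)
  have hres := (hC.stronglyMeasurable_compressionResidual (hξ.measurable t k) hS').aestronglyMeasurable
    (μ := P)
  have hα := Real.sqrt_nonneg α
  have hr : eLpNorm (fun ω => networkNorm (compressionResidual C (fun n => ξ t k n ω) (S ω))) 2 P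
      ≤ ENNReal.ofReal (√α * y) := by
    refine eLpNorm_two_le_of_lintegral_le hC.nonneg ?_ h2
    simp only [enorm_networkNorm_sq]
    rw [lintegral_finsetSum' _ fun n _ => ?_, lintegral_finsetSum' _ fun n _ => ?_,
      Finset.mul_sum]
    · refine Finset.sum_le_sum fun n _ => ?_
      refine hC.lintegral_residual_le (hξ.measurable t k n) (hξ.law t k n)
        ((hS' n).1.sub (hS' n).2) ?_
      rw [IndepFun_iff_Indep]
      exact indep_of_indep_of_le_right (hξ.indep_past t k n)
        ((hS n).1.sub (hS n).2).measurable.comap_le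
    · exact (((hS' n).1.sub (hS' n).2).enorm.pow_const 2).aemeasurable
    · exact ((((hS' n).1.sub (hS' n).2).sub (hC.stronglyMeasurable_comp (hξ.measurable t k n)
        ((hS' n).1.sub (hS' n).2))).enorm.pow_const 2).aemeasurable
  have hαy : 0 ≤ √α * y := by positivity
  have hγμ : γ * (1 - ρ) ≤ 1 := by nlinarith
  refine ⟨(1 - γ * (1 - ρ)) * x + 2 * γ * (√α * y), 2 * γ * x + (1 + 2 * γ) * (√α * y),
    ?_, by positivity, ?_, ?_, ?_⟩
  · have : 0 ≤ 1 - γ * (1 - ρ) := by linarith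
    positivity
  · exact eLpNorm_two_le_of_le_add (by linarith) (by positivity) hx hαy hdev hres
      (fun ω => networkNorm_nonneg _)
      (fun ω => hW.networkNorm_dev_gossipStep_le hρ hγ0.le hγ1 C _ _) h1 hr
  · exact eLpNorm_two_le_of_le_add (by positivity) (by positivity) hx hαy hdev hres
      (fun ω => networkNorm_nonneg _)
      (fun ω => hW.networkNorm_gossipStep_sub_le hγ0.le C _ _) h1 hr
  · have hη : 0 ≤ 1 - γ * (1 - ρ) / 2 := by linarith
    refine le_trans ?_ (mul_le_mul_of_nonneg_left h3 hη)
    have hcond' : 2 * γ * √α + (1 - ρ) / 4 * ((1 + 2 * γ) * √α)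
        ≤ (1 - ρ) / 4 * (1 - γ * (1 - ρ) / 2) := by
      have e : (1 - ρ) / 4 * (γ * (2 * √α * (1 + 4 / (1 - ρ)) + (1 - ρ) / 2))
          = (1 - ρ) / 4 * (γ * (2 * √α + (1 - ρ) / 2)) + 2 * γ * √α := by
        field_simp
        ring
      have := mul_le_mul_of_nonneg_left hcond (show 0 ≤ (1 - ρ) / 4 by linarith)
      rw [e] at this
      linarith
    have := mul_le_mul_of_nonneg_right hcond' hy
    linarith

/-! ### Runs -/

theorem IsCompressor.isMeasurableState_gossipLoop (hC : IsCompressor ν C α) (t : ℕ)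
    {S : Ω₀ → (Fin N → H) × (Fin N → H)} (hS : IsMeasurableState (history ξ t) S) (k : ℕ) :
    IsMeasurableState (past ξ t k)
      (fun ω => gossipLoop W γ C (fun k n => ξ t k n ω) (S ω) k) := by
  induction k with
  | zero => exact hS.mono (history_le_past t 0)
  | succ k ih =>
    exact hC.isMeasurableState_gossipStep
      (fun n => measurable_past (Or.inr ⟨rfl, Nat.lt_succ_self k⟩) n)
      (ih.mono (past_le_past_succ t k))

theorem IsGossipMatrix.lyapunovBound_gossipLoop (hW : IsGossipMatrix 𝒢 W)
    (hρ : IsContractionFactor H W ρ) [IsProbabilityMeasure ν] [IsProbabilityMeasure P]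
    (hC : IsCompressor ν C α) (hγ0 : 0 < γ) (hγ : γ ≤ maxStepSize α (1 - ρ))
    (hξ : IsFresh P ν ξ) (t : ℕ) {S : Ω₀ → (Fin N → H) × (Fin N → H)}
    (hS : IsMeasurableState (history ξ t) S) {b : ℝ} (h : LyapunovBound P (1 - ρ) S b) (k : ℕ) :
    LyapunovBound P (1 - ρ) (fun ω => gossipLoop W γ C (fun k n => ξ t k n ω) (S ω) k)
      ((1 - γ * (1 - ρ) / 2) ^ k * b) := by
  induction k with
  | zero => simpa [gossipLoop] using h
  | succ k ih =>
    rw [pow_succ', mul_assoc]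
    exact hW.lyapunovBound_gossipStep hρ hC hγ0 hγ hξ t k
      (hC.isMeasurableState_gossipLoop t hS k) ih

/-- The state of a run at the start of round `t`, as a random variable. -/
def runState (W : Matrix (Fin N) (Fin N) ℝ) (γ : ℝ) (C : Ω → H → H) (q : ℕ → ℕ)
    (ξ : ℕ → ℕ → Fin N → Ω₀ → Ω) (g : ℕ → Fin N → Ω₀ → H) (t : ℕ) (ω : Ω₀) :
    (Fin N → H) × (Fin N → H) :=
  state W γ C q (fun t k n => ξ t k n ω) (fun t n => g t n ω) t

variable {q : ℕ → ℕ} {g : ℕ → Fin N → Ω₀ → H}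

theorem IsCompressor.isMeasurableState_runState (hC : IsCompressor ν C α)
    (hg : ∀ t n, StronglyMeasurable[history ξ t] (g t n)) (t : ℕ) :
    IsMeasurableState (history ξ t) (runState W γ C q ξ g t) := by
  induction t with
  | zero => exact fun n => ⟨stronglyMeasurable_const, stronglyMeasurable_const⟩
  | succ t ih =>
    refine (hC.isMeasurableState_gossipLoop t (S := fun ω => (fun n =>
      (runState W γ C q ξ g t ω).1 n - g t n ω, (runState W γ C q ξ g t ω).2))
      (fun n => ⟨(ih n).1.sub (hg t n), (ih n).2⟩) (q t)).mono (past_le_history t (q t))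

/-- Subtracting unit-bounded gradients adds at most `2√N` to the consensus error and `√N` to the
tracking error, before gossip contracts both. -/
theorem IsGossipMatrix.lyapunovBound_runState_succ (hW : IsGossipMatrix 𝒢 W)
    (hρ : IsContractionFactor H W ρ) [IsProbabilityMeasure ν] [IsProbabilityMeasure P]
    (hC : IsCompressor ν C α) (hγ0 : 0 < γ) (hγ : γ ≤ maxStepSize α (1 - ρ))
    (hξ : IsFresh P ν ξ) (hg : ∀ t n, StronglyMeasurable[history ξ t] (g t n))
    (hg1 : ∀ t n ω, ‖g t n ω‖ ≤ 1) (t : ℕ) {b : ℝ}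
    (h : LyapunovBound P (1 - ρ) (runState W γ C q ξ g t) b) :
    LyapunovBound P (1 - ρ) (runState W γ C q ξ g (t + 1))
      ((1 - γ * (1 - ρ) / 2) ^ q t * (b + (2 + (1 - ρ) / 4) * √N)) := by
  have hmeas := hC.isMeasurableState_runState (W := W) (γ := γ) (q := q) hg t
  have hmeas' := hmeas.mono (hξ.history_le t)
  refine hW.lyapunovBound_gossipLoop hρ hC hγ0 hγ hξ t (S := fun ω => (fun n =>
      (runState W γ C q ξ g t ω).1 n - g t n ω, (runState W γ C q ξ g t ω).2))
      (fun n => ⟨(hmeas n).1.sub (hg t n), (hmeas n).2⟩) ?_ (q t)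
  obtain ⟨x, y, hx, hy, h1, h2, h3⟩ := h
  have hconst : ∀ c : ℝ, 0 ≤ c → eLpNorm (fun _ : Ω₀ => c) 2 P ≤ ENNReal.ofReal c := by
    intro c hc
    rw [eLpNorm_const _ (by norm_num) (IsProbabilityMeasure.ne_zero P)]
    simp [Real.enorm_of_nonneg hc]
  refine ⟨1 * x + 1 * (2 * 1 * √N), 1 * y + 1 * (1 * √N), by positivity, by positivity, ?_, ?_, ?_⟩
  · refine eLpNorm_two_le_of_le_add zero_le_one zero_le_one hx (by positivity)
      hmeas'.dev.aestronglyMeasurable aestronglyMeasurable_const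
      (fun ω => networkNorm_nonneg _) (fun ω => ?_) h1 (hconst (2 * 1 * √N) (by positivity))
    rw [one_mul, one_mul]
    have e : dev (fun n => (runState W γ C q ξ g t ω).1 n - g t n ω)
        = dev (runState W γ C q ξ g t ω).1 - dev (fun n => g t n ω) := dev_sub _ _
    rw [e]
    exact (networkNorm_sub_le _ _).trans (add_le_add_right
      (networkNorm_dev_le_of_forall_le zero_le_one fun n => hg1 t n ω) _)
  · refine eLpNorm_two_le_of_le_add zero_le_one zero_le_one hy (by positivity)
      hmeas'.sub.aestronglyMeasurable aestronglyMeasurable_const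
      (fun ω => networkNorm_nonneg _) (fun ω => ?_) h2 (hconst (1 * √N) (by positivity))
    rw [one_mul, one_mul]
    have e : (fun n => (runState W γ C q ξ g t ω).1 n - g t n ω) - (runState W γ C q ξ g t ω).2
        = (runState W γ C q ξ g t ω).1 - (runState W γ C q ξ g t ω).2 - fun n => g t n ω := by
      funext n
      simp only [Pi.sub_apply]
      abel
    rw [e]
    exact (networkNorm_sub_le _ _).trans (add_le_add_right
      (networkNorm_le_of_forall_le zero_le_one fun n => hg1 t n ω) _)
  · linarith

theorem lyapunovBound_runState_zero {μ : ℝ} :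
    LyapunovBound P μ (runState W γ C q ξ g 0) 0 := by
  refine ⟨0, 0, le_rfl, le_rfl, ?_, ?_, by simp⟩ <;>
    simp [runState, state, dev, mean, networkNorm]

/-- Geometric decay of the mean-square consensus error along a run. -/
theorem IsGossipMatrix.lyapunovBound_runState (hW : IsGossipMatrix 𝒢 W)
    (hρ : IsContractionFactor H W ρ) [IsProbabilityMeasure ν] [IsProbabilityMeasure P]
    (hC : IsCompressor ν C α) (hγ0 : 0 < γ) (hγ : γ ≤ maxStepSize α (1 - ρ))
    (hξ : IsFresh P ν ξ) (hg : ∀ t n, StronglyMeasurable[history ξ t] (g t n))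
    (hg1 : ∀ t n ω, ‖g t n ω‖ ≤ 1) {θ : ℝ} (hθ0 : 0 ≤ θ) (hθ1 : θ ≤ 1 / 2)
    (hθ : ∀ t, (1 - γ * (1 - ρ) / 2) ^ q t ≤ θ ^ t) (t : ℕ) :
    LyapunovBound P (1 - ρ) (runState W γ C q ξ g (t + 1))
      (2 * θ ^ t * ((2 + (1 - ρ) / 4) * √N)) := by
  set A : ℝ := (2 + (1 - ρ) / 4) * √N with hA
  have hμ : 0 < 1 - ρ := by linarith [hρ.lt_one]
  have hA0 : 0 ≤ A := by positivity
  have hstep : ∀ t b, 0 ≤ b → LyapunovBound P (1 - ρ) (runState W γ C q ξ g t) b →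
      LyapunovBound P (1 - ρ) (runState W γ C q ξ g (t + 1)) (θ ^ t * (b + A)) :=
    fun t b hb h => (hW.lyapunovBound_runState_succ hρ hC hγ0 hγ hξ hg hg1 t h).mono
      (mul_le_mul_of_nonneg_right (hθ t) (add_nonneg hb hA0))
  -- The bound `A` is invariant once `θ ^ t ≤ 1/2`. Round `0` has no such contraction, but it starts
  -- from error zero and so ends with at most `A`.
  have hA' : ∀ t, LyapunovBound P (1 - ρ) (runState W γ C q ξ g t) A := by
    intro t
    induction t with
    | zero => exact lyapunovBound_runState_zero.mono hA0
    | succ t ih =>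
      rcases Nat.eq_zero_or_pos t with rfl | ht
      · simpa using hstep 0 0 le_rfl lyapunovBound_runState_zero
      · refine (hstep t A hA0 ih).mono ?_
        have : θ ^ t ≤ 1 / 2 := (pow_le_of_le_one hθ0 (by linarith) ht.ne').trans hθ1
        nlinarith
  exact (hstep t A hA0 (hA' t)).mono (by linarith)

/-! ### Integrability of the regret -/

/-- Losses are measurable only at fixed points; approximating `X` by simple functions and using
continuity in the point extends this to random points. -/
theorem stronglyMeasurable_apply_of_continuous {f : Ω₀ → H → ℝ}
    (hf : ∀ x, Measurable fun ω => f ω x) (hc : ∀ ω, Continuous (f ω)) {X : Ω₀ → H}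
    (hX : StronglyMeasurable X) : StronglyMeasurable fun ω => f ω (X ω) := by
  refine Measurable.stronglyMeasurable ?_
  refine measurable_of_tendsto_metrizable (f := fun n ω => f ω (hX.approx n ω))
    (fun n => (hX.approx n).measurable_bind (fun x ω => f ω x) hf) ?_
  exact tendsto_pi_nhds.2 fun ω => ((hc ω).tendsto _).comp (hX.tendsto_approx ω)

variable {ε : ℝ} {ℓ : ℕ → Fin N → Ω₀ → H → ℝ}

theorem IsLossSequence.integrable_runRegret [IsProbabilityMeasure P]
    (hℓ : IsLossSequence ξ ℓ) (hN : 0 < N) (hC : IsCompressor ν C α) (hξ : IsFresh P ν ξ)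
    (pot : Potential) (hε : 0 < ε) (hg : ∀ t n, StronglyMeasurable[history ξ t] (g t n))
    (u : H) (T : ℕ) :
    Integrable (runRegret (pot.fn ε) W γ C q ξ ℓ g u T) P := by
  have hN' : (0 : ℝ) < N := by exact_mod_cast hN
  have hmono := hξ.history_le
  have hpred : ∀ t n, StronglyMeasurable (fun ω => prediction (pot.fn ε) W γ C q
      (fun t k n => ξ t k n ω) (fun t n => g t n ω) t n) := by
    intro t n
    have hcont : Continuous (fun G : H => bet (pot.fn ε) (t + 1) (clip (t : ℝ) G)) := by
      refine (LipschitzWith.of_dist_le_mul (K := ⟨pot.lip ε t, pot.lip_nonneg hε t⟩)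
        fun G G' => ?_).continuous
      rw [dist_eq_norm, dist_eq_norm]
      exact pot.norm_bet_clip_sub_le hε t G G'
    exact hcont.comp_stronglyMeasurable
      ((hC.isMeasurableState_runState (W := W) (γ := γ) (q := q) hg t n).1.mono (hmono t))
  have hloss : ∀ t, ∀ X : Ω₀ → H, StronglyMeasurable X →
      StronglyMeasurable (fun ω => networkLoss (fun n => ℓ t n ω) (X ω)) := by
    intro t X hX
    simp only [networkLoss, div_eq_mul_inv]
    refine StronglyMeasurable.mul_const (Finset.stronglyMeasurable_fun_sum _ fun n _ => ?_) _
    exact stronglyMeasurable_apply_of_continuous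
      (fun x => (hℓ.measurable t n x).mono (hmono t) le_rfl)
      (fun ω => (hℓ.lipschitz t n ω).continuous) hX
  have hmeas : StronglyMeasurable (runRegret (pot.fn ε) W γ C q ξ ℓ g u T) := by
    refine StronglyMeasurable.sub (Finset.stronglyMeasurable_fun_sum _ fun t _ => ?_)
      (Finset.stronglyMeasurable_fun_sum _ fun t _ => hloss t _ stronglyMeasurable_const)
    simp only [div_eq_mul_inv]
    exact StronglyMeasurable.mul_const
      (Finset.stronglyMeasurable_fun_sum _ fun n _ => hloss t _ (hpred t n)) _
  -- Clipping bounds the predictions deterministically, hence the regret too.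
  refine Integrable.of_bound hmeas.aestronglyMeasurable
    (∑ t ∈ Finset.range T, (pot.lip ε t * t + ‖u‖)) (Filter.Eventually.of_forall fun ω => ?_)
  rw [runRegret, networkRegret, ← Finset.sum_sub_distrib]
  refine norm_sum_le_of_le _ fun t _ => ?_
  set x := prediction (pot.fn ε) W γ C q (fun t k n => ξ t k n ω) (fun t n => g t n ω) t with hx
  have e : (∑ n, networkLoss (fun n => ℓ t n ω) (x n)) / N - networkLoss (fun n => ℓ t n ω) u
      = (∑ n, (networkLoss (fun n => ℓ t n ω) (x n) - networkLoss (fun n => ℓ t n ω) u)) / N := by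
    rw [Finset.sum_sub_distrib]
    simp only [Finset.sum_const, Finset.card_univ, Fintype.card_fin, nsmul_eq_mul]
    field_simp
  rw [e, norm_div, Real.norm_natCast, div_le_iff₀ hN']
  calc _ ≤ ∑ _n : Fin N, (pot.lip ε t * t + ‖u‖) := by
        refine norm_sum_le_of_le _ fun n _ => ?_
        rw [Real.norm_eq_abs]
        refine (abs_networkLoss_sub_le hN (fun n => hℓ.lipschitz t n ω) _ _).trans ?_
        exact (norm_sub_le _ _).trans (add_le_add_left (pot.norm_bet_clip_le hε t _) _)
    _ = _ := by
        simp
        ring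

end Probability

/-! ### The linear schedule -/

theorem Potential.minSchedule_eq (P : Potential) (η : ℝ) :
    P.minSchedule η = Real.log P.rate / Real.log η := by
  cases P with
  | KT =>
    have : Real.log (1 / 4) = -(2 * Real.log 2) := by
      rw [one_div, Real.log_inv, show (4 : ℝ) = 2 ^ 2 by norm_num, Real.log_pow]
      push_cast
      ring
    rw [Potential.minSchedule, Potential.rate, this]
  | SE =>
    rw [Potential.minSchedule, Potential.rate, Real.log_exp, ← div_div, neg_div]

/-- The minimal constant is `log rate / log η`, so `η^(c t) ≤ rate^t`; rounding up only helps
because `η < 1`. -/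
theorem Potential.pow_linearSchedule_le (P : Potential) {η c : ℝ} (hη0 : 0 < η) (hη1 : η < 1)
    (hc : P.minSchedule η ≤ c) (t : ℕ) : η ^ linearSchedule c t ≤ P.rate ^ t := by
  have hlog : Real.log η < 0 := Real.log_neg hη0 hη1
  rw [P.minSchedule_eq, div_le_iff_of_neg hlog] at hc
  have hq : c * t ≤ (linearSchedule c t : ℝ) := Nat.le_ceil _
  rw [← Real.exp_log hη0, ← Real.exp_log P.rate_pos, ← Real.exp_nat_mul, ← Real.exp_nat_mul]
  apply Real.exp_le_exp.2
  have h1 := mul_le_mul_of_nonpos_right hq hlog.le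
  have h2 := mul_le_mul_of_nonneg_left hc (Nat.cast_nonneg (α := ℝ) t)
  linarith

/-! ### Order of the closed-form bound -/

theorem one_le_log_two_add {T : ℕ} (hT : 1 ≤ T) {r : ℝ} (hr : 0 ≤ r) :
    1 ≤ Real.log (2 + T + r) := by
  have hT' : (1 : ℝ) ≤ T := by exact_mod_cast hT
  rw [Real.le_log_iff_exp_le (by linarith)]
  linarith [Real.exp_one_lt_d9]

/-- A quartic polynomial inside the logarithm costs only a constant times `log s`; the square root
is dropped because the bound is at least one. -/
theorem sqrt_log_one_add_le {a X s : ℝ} (ha : 0 ≤ a) (hX0 : 0 ≤ X) (hs : 1 ≤ s)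
    (hX : X ≤ a * s ^ 4) (hls : 1 ≤ Real.log s) :
    √(Real.log (1 + X)) ≤ (Real.log (1 + a) + 4) * Real.log s := by
  have hla : 0 ≤ Real.log (1 + a) := Real.log_nonneg (by linarith)
  have h1 : Real.log (1 + X) ≤ Real.log (1 + a) + 4 * Real.log s := by
    have e : Real.log ((1 + a) * s ^ 4) = Real.log (1 + a) + 4 * Real.log s := by
      rw [Real.log_mul (by linarith) (by positivity), Real.log_pow]
      push_cast
      ring
    rw [← e]
    apply Real.log_le_log (by linarith)
    nlinarith [one_le_pow₀ hs (n := 4)]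
  have h2 : Real.log (1 + X) ≤ (Real.log (1 + a) + 4) * Real.log s := by nlinarith
  have h3 : 1 ≤ (Real.log (1 + a) + 4) * Real.log s := by nlinarith
  rw [Real.sqrt_le_left (by linarith)]
  nlinarith

theorem abs_add_add_mul_sqrt_le {A B R ε M m L : ℝ} {T : ℕ} (hT : 1 ≤ T) (hm : 1 ≤ m)
    (hL : 1 ≤ L) (hA0 : 0 ≤ A) (hA : A ≤ m * (2 * √T) * (M * L)) (hB0 : 0 ≤ B) (hB : B ≤ ε) :
    |A + B + R * √T| ≤ (2 * M + ε + |R|) * |m * √T| * L ^ 1 := by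
  have hs : 1 ≤ √(T : ℝ) := Real.one_le_sqrt.2 (by exact_mod_cast hT)
  have hm0 : 0 ≤ m * √(T : ℝ) := by positivity
  rw [abs_of_nonneg hm0, pow_one]
  have h1 : 1 ≤ m * √(T : ℝ) * L := one_le_mul_of_one_le_of_one_le
    (one_le_mul_of_one_le_of_one_le hm hs) hL
  have h2 : √(T : ℝ) ≤ m * √(T : ℝ) * L := by
    calc √(T : ℝ) ≤ m * √(T : ℝ) := le_mul_of_one_le_left (by positivity) hm
      _ ≤ _ := le_mul_of_one_le_right hm0 hL
  calc |A + B + R * √T| ≤ |A| + |B| + |R * √T| := abs_add_three _ _ _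
    _ = A + B + |R| * √T := by
      rw [abs_of_nonneg hA0, abs_of_nonneg hB0, abs_mul, abs_of_nonneg (Real.sqrt_nonneg _)]
    _ ≤ m * (2 * √T) * (M * L) + ε * (m * √(T : ℝ) * L) + |R| * (m * √(T : ℝ) * L) := by
      refine add_le_add (add_le_add hA ?_) (mul_le_mul_of_nonneg_left h2 (abs_nonneg R))
      exact hB.trans (le_mul_of_one_le_right (hB0.trans hB) h1)
    _ = _ := by ring

theorem mul_one_sub_one_div_mem_Icc {ε x : ℝ} (hε : 0 < ε) (hx : 1 ≤ x) :
    ε * (1 - 1 / x) ∈ Set.Icc 0 ε := by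
  have h1 : 1 / x ≤ 1 := (div_le_one (by linarith)).2 hx
  have h2 : 0 ≤ 1 / x := by positivity
  constructor <;> nlinarith

theorem Potential.isSoftO_closedForm (P : Potential) {ε : ℝ} (hε : 0 < ε) (N : ℕ) (μ : ℝ) :
    IsSoftO (P.closedForm ε N μ) (fun T r => max 1 r * √T) := by
  have hsq : ∀ T : ℕ, 1 ≤ T → √((T : ℝ) + 1) ≤ √(2 * ((T : ℝ) + 1)) ∧
      √(2 * ((T : ℝ) + 1)) ≤ 2 * √T := by
    intro T hT
    have hT' : (1 : ℝ) ≤ T := by exact_mod_cast hT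
    refine ⟨Real.sqrt_le_sqrt (by linarith), Real.sqrt_le_iff.2 ⟨by positivity, ?_⟩⟩
    rw [mul_pow, Real.sq_sqrt (by positivity)]
    linarith
  cases P with
  | KT =>
    set a : ℝ := 2 * Real.exp 1 ^ 2 * Real.pi / ε ^ 2 with ha
    refine ⟨2 * (Real.log (1 + a) + 4) + ε + |Potential.KT.regConst ε N μ|, 1,
      fun T hT r hr => ?_⟩
    have hT' : (1 : ℝ) ≤ T := by exact_mod_cast hT
    have hL := one_le_log_two_add hT hr
    have hlog := sqrt_log_one_add_le (a := a)
      (X := 2 * Real.exp 1 ^ 2 * Real.pi * T * ((T : ℝ) + 1) * r ^ 2 / ε ^ 2)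
      (s := 2 + T + r) (by positivity) (by positivity) (by linarith) (by
        have h1 : (T : ℝ) * (T + 1) ≤ (2 + T + r) ^ 2 := by nlinarith
        have h2 : r ^ 2 ≤ (2 + T + r) ^ 2 := pow_le_pow_left₀ hr (by linarith) 2
        have h3 := mul_le_mul h1 h2 (sq_nonneg r) (sq_nonneg _)
        calc _ = a * ((T : ℝ) * (T + 1) * r ^ 2) := by rw [ha]; ring
          _ ≤ a * ((2 + T + r) ^ 2 * (2 + T + r) ^ 2) := by gcongr
          _ = _ := by ring) hL
    have hB := mul_one_sub_one_div_mem_Icc hε (x := Real.exp 1 * √(Real.pi * T))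
      (one_le_mul_of_one_le_of_one_le (Real.one_le_exp zero_le_one)
        (Real.one_le_sqrt.2 (by nlinarith [Real.pi_gt_three])))
    simp only [Potential.closedForm]
    refine abs_add_add_mul_sqrt_le hT (le_max_left 1 r) hL (by positivity) ?_ hB.1 hB.2
    exact mul_le_mul (mul_le_mul (le_max_right 1 r) (hsq T hT).2 (by positivity) (by positivity))
      hlog (by positivity) (by positivity)
  | SE =>
    refine ⟨2 * (Real.log (1 + 1 / ε ^ 2) + 4) + ε + |Potential.SE.regConst ε N μ|, 1,
      fun T hT r hr => ?_⟩
    have hT' : (1 : ℝ) ≤ T := by exact_mod_cast hT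
    have hL := one_le_log_two_add hT hr
    have hlog := sqrt_log_one_add_le (a := 1 / ε ^ 2)
      (X := ((T : ℝ) + 1) ^ 2 * r ^ 2 / ε ^ 2)
      (s := 2 + T + r) (by positivity) (by positivity) (by linarith) (by
        have h1 : ((T : ℝ) + 1) ^ 2 ≤ (2 + T + r) ^ 2 :=
          pow_le_pow_left₀ (by linarith) (by linarith) 2
        have h2 : r ^ 2 ≤ (2 + T + r) ^ 2 := pow_le_pow_left₀ hr (by linarith) 2
        have h3 := mul_le_mul h1 h2 (sq_nonneg r) (sq_nonneg _)
        calc _ = 1 / ε ^ 2 * (((T : ℝ) + 1) ^ 2 * r ^ 2) := by ring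
          _ ≤ 1 / ε ^ 2 * ((2 + T + r) ^ 2 * (2 + T + r) ^ 2) := by gcongr
          _ = _ := by ring) hL
    have hB := mul_one_sub_one_div_mem_Icc hε (x := √((T : ℝ) + 1))
      (Real.one_le_sqrt.2 (by linarith))
    simp only [Potential.closedForm]
    refine abs_add_add_mul_sqrt_le hT (le_max_left 1 r) hL (by positivity) ?_ hB.1 hB.2
    rw [Real.sqrt_mul (by positivity), ← mul_assoc]
    exact mul_le_mul (mul_le_mul (le_max_right 1 r) ((hsq T hT).1.trans (hsq T hT).2)
      (by positivity) (by positivity)) hlog (by positivity) (by positivity)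

/-! ### Expected regret -/

section Expectation

variable {H : Type*} [NormedAddCommGroup H] [InnerProductSpace ℝ H] [MeasurableSpace H]
  [BorelSpace H] {N : ℕ} {𝒢 : SimpleGraph (Fin N)} {W : Matrix (Fin N) (Fin N) ℝ}
  {Ω : Type*} [MeasurableSpace Ω] {ν : Measure Ω} [IsProbabilityMeasure ν]
  {C : Ω → H → H} {α : ℝ} {Ω₀ : Type*} [MeasurableSpace Ω₀] {P : Measure Ω₀}
  [IsProbabilityMeasure P] {ξ : ℕ → ℕ → Fin N → Ω₀ → Ω} {ℓ : ℕ → Fin N → Ω₀ → H → ℝ}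
  {ε ρ γ c : ℝ} {g : ℕ → Fin N → Ω₀ → H}

/-- The expected weighted errors form a convergent series and the `√N` of the Lyapunov bound
cancels, so the sum is bounded by a constant; the factors `√N` and `√T` on the right are slack. -/
theorem IsGossipMatrix.sum_integral_dev_le (hW : IsGossipMatrix 𝒢 W) (hN : 0 < N)
    (hρ : IsContractionFactor H W ρ) (hC : IsCompressor ν C α) (hξ : IsFresh P ν ξ)
    (pot : Potential) (hε : 0 < ε) (hγ0 : 0 < γ) (hγ : γ ≤ maxStepSize α (1 - ρ))
    (hc : pot.minSchedule (1 - γ * (1 - ρ) / 2) ≤ c)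
    (hg : ∀ t n, StronglyMeasurable[history ξ t] (g t n)) (hg1 : ∀ t n ω, ‖g t n ω‖ ≤ 1)
    {T : ℕ} (hT : 1 ≤ T) :
    (∀ t, Integrable (fun ω =>
      networkNorm (dev (runState W γ C (linearSchedule c) ξ g t ω).1)) P) ∧
    ∑ t ∈ Finset.range T, 3 * pot.lip ε t / √N *
      ∫ ω, networkNorm (dev (runState W γ C (linearSchedule c) ξ g t ω).1) ∂P
        ≤ pot.regConst ε N (1 - ρ) * √T := by
  have hμ : 0 < 1 - ρ := by linarith [hρ.lt_one]
  have hρ0 := hρ.nonneg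
  have hγ1 : γ ≤ 1 := hγ.trans (min_le_left _ _)
  have hsN : 1 ≤ √(N : ℝ) := Real.one_le_sqrt.2 (by exact_mod_cast hN)
  have hsT : 1 ≤ √(T : ℝ) := Real.one_le_sqrt.2 (by exact_mod_cast hT)
  have hη : ∀ t, (1 - γ * (1 - ρ) / 2) ^ linearSchedule c t ≤ pot.rate ^ t := fun t =>
    pot.pow_linearSchedule_le (by nlinarith) (by nlinarith [mul_pos hγ0 hμ]) hc t
  have hmeas : ∀ t, IsMeasurableState ‹MeasurableSpace Ω₀›
      (runState W γ C (linearSchedule c) ξ g t) := fun t =>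
    (hC.isMeasurableState_runState hg t).mono (hξ.history_le t)
  have hsucc := fun t => (hW.lyapunovBound_runState hρ hC hγ0 hγ hξ hg hg1 pot.rate_pos.le
    pot.rate_le hη t).integrable_and_integral_le hμ.le (hmeas (t + 1))
  have hzero := (lyapunovBound_runState_zero (P := P) (μ := 1 - ρ) (W := W) (γ := γ) (C := C)
    (q := linearSchedule c) (ξ := ξ) (g := g)).integrable_and_integral_le hμ.le (hmeas 0)
  refine ⟨fun t => ?_, ?_⟩
  · cases t with
    | zero => exact hzero.1
    | succ t => exact (hsucc t).1
  obtain ⟨T, rfl⟩ : ∃ T', T = T' + 1 := ⟨T - 1, by omega⟩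
  -- The round-`0` term is split off: all states are zero there, and the geometric bound starts at
  -- round `1`.
  rw [Finset.sum_range_succ']
  have hS := pot.sum_lip_mul_rate_le hε T
  have hS0 : 0 ≤ ∑ s ∈ Finset.range T, pot.lip ε (s + 1) * pot.rate ^ s :=
    Finset.sum_nonneg fun s _ => mul_nonneg (pot.lip_nonneg hε _) (pow_nonneg pot.rate_pos.le _)
  have h0 := mul_nonpos_of_nonneg_of_nonpos
    (show 0 ≤ 3 * pot.lip ε 0 / √N by have := pot.lip_nonneg hε 0; positivity) hzero.2
  have h1 : ∑ t ∈ Finset.range T, 3 * pot.lip ε (t + 1) / √N *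
      ∫ ω, networkNorm (dev (runState W γ C (linearSchedule c) ξ g (t + 1) ω).1) ∂P
      ≤ 6 * (2 + (1 - ρ) / 4) * ∑ s ∈ Finset.range T, pot.lip ε (s + 1) * pot.rate ^ s := by
    rw [Finset.mul_sum]
    refine Finset.sum_le_sum fun t _ => ?_
    have hl := pot.lip_nonneg hε (t + 1)
    refine (mul_le_mul_of_nonneg_left (hsucc t).2 (by positivity)).trans_eq ?_
    field_simp
    ring
  have h2 : 6 * (2 + (1 - ρ) / 4) * ∑ s ∈ Finset.range T, pot.lip ε (s + 1) * pot.rate ^ s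
      ≤ 6 * (2 + (1 - ρ) / 4) * (pot.schedConst ε / 4) :=
    mul_le_mul_of_nonneg_left hS (by linarith)
  have h3 : 6 * (2 + (1 - ρ) / 4) * (pot.schedConst ε / 4)
      ≤ 6 * (2 + (1 - ρ) / 4) * (pot.schedConst ε / 4) * (√N * √(T + 1 : ℕ)) :=
    le_mul_of_one_le_right (mul_nonneg (by linarith) (hS0.trans hS))
      (one_le_mul_of_one_le_of_one_le hsN hsT)
  rw [Potential.regConst]
  linarith

theorem IsGossipMatrix.integral_runRegret_le (hW : IsGossipMatrix 𝒢 W) (hN : 0 < N)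
    (hρ : IsContractionFactor H W ρ) (hC : IsCompressor ν C α) (hξ : IsFresh P ν ξ)
    (hℓ : IsLossSequence ξ ℓ) (pot : Potential) (hε : 0 < ε) (hγ0 : 0 < γ)
    (hγ : γ ≤ maxStepSize α (1 - ρ)) (hc : pot.minSchedule (1 - γ * (1 - ρ) / 2) ≤ c)
    (hrun : IsRun (pot.fn ε) W γ C (linearSchedule c) ξ ℓ g) (u : H) {T : ℕ} (hT : 1 ≤ T) :
    ∫ ω, runRegret (pot.fn ε) W γ C (linearSchedule c) ξ ℓ g u T ω ∂P
      ≤ pot.closedForm ε N (1 - ρ) T ‖u‖ := by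
  have hg1 : ∀ t n ω, ‖g t n ω‖ ≤ 1 := fun t n ω =>
    (hrun.subgradient t n ω).norm_le_one (hℓ.lipschitz t n ω)
  obtain ⟨hint, hsum⟩ := hW.sum_integral_dev_le hN hρ hC hξ pot hε hγ0 hγ hc hrun.measurable hg1 hT
  have hint' : ∀ t ∈ Finset.range T, Integrable (fun ω => 3 * pot.lip ε t / √N *
      networkNorm (dev (runState W γ C (linearSchedule c) ξ g t ω).1)) P :=
    fun t _ => (hint t).const_mul _
  calc _ ≤ ∫ ω, (pot.closedForm ε N (1 - ρ) T ‖u‖ - pot.regConst ε N (1 - ρ) * √T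
        + ∑ t ∈ Finset.range T, 3 * pot.lip ε t / √N *
          networkNorm (dev (runState W γ C (linearSchedule c) ξ g t ω).1)) ∂P := by
        refine integral_mono (hℓ.integrable_runRegret hN hC hξ pot hε hrun.measurable u T)
          ((integrable_const _).add (integrable_finsetSum _ hint')) fun ω => ?_
        exact hW.networkRegret_le hN pot hε C _ _ _ (fun t n => hℓ.lipschitz t n ω)
          (fun t n => hrun.subgradient t n ω) u hT (1 - ρ)
    _ = pot.closedForm ε N (1 - ρ) T ‖u‖ - pot.regConst ε N (1 - ρ) * √T
        + ∑ t ∈ Finset.range T, 3 * pot.lip ε t / √N *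
          ∫ ω, networkNorm (dev (runState W γ C (linearSchedule c) ξ g t ω).1) ∂P := by
        rw [integral_add (integrable_const _) (integrable_finsetSum _ hint'),
          integral_finsetSum _ hint', integral_const]
        simp only [integral_const_mul, probReal_univ, one_smul]
    _ ≤ _ := by linarith

end Expectation

end DecoEF

end

theorem mainTheorem3 {H : Type*} [NormedAddCommGroup H] [InnerProductSpace ℝ H]
    [CompleteSpace H] [MeasurableSpace H] [BorelSpace H]
    {N : ℕ} (𝒢 : SimpleGraph (Fin N)) (h𝒢 : 𝒢.Connected)
    (W : Matrix (Fin N) (Fin N) ℝ) (hW : DecoEF.IsGossipMatrix 𝒢 W)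
    {Ω : Type*} [MeasurableSpace Ω] (ν : Measure Ω) [IsProbabilityMeasure ν]
    (C : Ω → H → H) (α : ℝ) (hC : DecoEF.IsCompressor ν C α)
    {Ω₀ : Type*} [MeasurableSpace Ω₀] (P : Measure Ω₀) [IsProbabilityMeasure P]
    (ξ : ℕ → ℕ → Fin N → Ω₀ → Ω) (hξ : DecoEF.IsFresh P ν ξ)
    (ℓ : ℕ → Fin N → Ω₀ → H → ℝ) (hℓ : DecoEF.IsLossSequence ξ ℓ)
    (pot : DecoEF.Potential) (ε : ℝ) (hε : 0 < ε) :
    (∃ ρ, DecoEF.IsContractionFactor H W ρ) ∧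
    ∀ ρ, DecoEF.IsContractionFactor H W ρ →
      DecoEF.IsSoftO (pot.closedForm ε N (1 - ρ)) (fun T r => max 1 r * Real.sqrt T) ∧
      ∀ γ : ℝ, 0 < γ → γ ≤ DecoEF.maxStepSize α (1 - ρ) →
      ∀ c : ℝ, pot.minSchedule (1 - γ * (1 - ρ) / 2) ≤ c →
      ∀ g : ℕ → Fin N → Ω₀ → H,
        DecoEF.IsRun (pot.fn ε) W γ C (DecoEF.linearSchedule c) ξ ℓ g →
      ∀ (u : H) (T : ℕ), 0 < T →
        Integrable
          (DecoEF.runRegret (pot.fn ε) W γ C (DecoEF.linearSchedule c) ξ ℓ g u T) P ∧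
        ∫ ω, DecoEF.runRegret (pot.fn ε) W γ C (DecoEF.linearSchedule c) ξ ℓ g u T ω ∂P ≤
          pot.closedForm ε N (1 - ρ) T ‖u‖ := by
  have hN : 0 < N := by
    obtain ⟨⟨n⟩⟩ := h𝒢.nonempty
    omega
  refine ⟨hW.exists_isContractionFactor H h𝒢, fun ρ hρ =>
    ⟨pot.isSoftO_closedForm hε N (1 - ρ), fun γ hγ0 hγ c hc g hrun u T hT => ⟨?_, ?_⟩⟩⟩
  · exact hℓ.integrable_runRegret hN hC hξ pot hε hrun.measurable u T
  · exact hW.integral_runRegret_le hN hρ hC hξ hℓ pot hε hγ0 hγ hc hrun u hT
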